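/- **Conventions.** Let $\mathcal S$ be an (elementary) topos. A *posetal fibration* on a category $\mathcal B$ is a faithful fibration $\mathcal P:|\mathcal P|\to\mathcal B$ (with a cleavage), i.e. a family of preorders $(\mathcal P_I)_{I\in\mathcal B}$ of predicates with pseudofunctorial monotone reindexing $u^*$; a *fibered monotone map* is a fibered functor over $\mathcal B$, these are preordered by fiberwise comparison, and an *equivalence* is a fibered monotone map with a pseudo-inverse. When we say that $\mathcal P$ has $\top,\wedge,\Rightarrow$ (or $\bot,\vee$), we mean that the fibers have them and that reindexing preserves them; $\forall$ along a map $f$ is a right adjoint of $f^*$, and Beck–Chevalley (BC) is always required for pullbacks along arbitrary maps. A *generic predicate* is $\mathrm{tr}\in\mathcal P_G$ such that every predicate is isomorphic to some $f^*\mathrm{tr}$. $\mathrm{sub}(\mathcal S)$ is the fibration of subobjects. $\mathcal S\downarrow\mathcal S$ is the arrow category; a map $(e,k):(M\to L)\to(N\to L')$ in it is vertical if $k$ is an identity. * A *one-sorted uniform preorder* in $\mathcal S$ is an object $A$ with a subobject $R\subseteq P(A\times A)$ which, in the internal logic, is downward closed, contains the identity relation and is closed under composition of relations. A monotone map $(A,R)\to(B,Q)$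 is a map $f:A\to B$ such that internally $r\in R$ implies $(f\times f)(r)\in Q$; $f\le g$ means $\{(fa,ga)\mid a\in A\}\in Q$. The fibration $\mathrm{ufam}(A,R)$ on $\mathcal S\downarrow\mathcal S$ has as predicates on $m:M\to L$ the maps $\varphi:M\to A$, reindexed by composition, with $\varphi\le\psi$ iff $\forall l{:}L.\ \{(\varphi x,\psi x)\mid x\in M_l\}\in R$ internally. We say that $(A,R)$ has $\top,\wedge,\Rightarrow,\forall$ if $\mathrm{ufam}(A,R)$ has $\top,\wedge,\Rightarrow$ and $\forall$ along vertical maps (with BC). * A *fibered tripos* on $\mathcal S$ is a posetal fibration $\mathcal X$ on $\mathcal S\downarrow\mathcal S$ such that: $e^*\varphi\le e^*\psi$ implies $\varphi\le\psi$ for every vertical epimorphism $e$; $\le$ is horizontally definable, i.e. for all $\varphi,\psi\in\mathcal X_{(m:M\to L)}$ there is a subobject $U$ of $L$ such that a map $t:T\to L$ factors through $U$ iff $t^*\varphi\le t^*\psi$ (restriction along the cartesian map $(M\times_LT\to T)\to m$ over $t$); $\mathcal X$ has $\top,\wedge,\bot,\vee,\Rightarrow$; $\mathcal X$ has $\forall$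 along vertical maps (with BC); and $\mathcal X$ has a generic predicate over an object of the form $G\to1$. * A *tripos with $\gamma$* on $\mathcal S$ is a posetal fibration $\mathcal P$ on $\mathcal S$ such that $e^*\varphi\le e^*\psi$ implies $\varphi\le\psi$ for regular epimorphisms $e$, which has $\top,\wedge,\Rightarrow$, $\forall$ along all maps (with BC) and a generic predicate, together with a finite-meet preserving fibered monotone map $\gamma:\mathcal P\to\mathrm{sub}(\mathcal S)$ such that $\top\le\gamma(p)$ implies $\top\le p$ for $p\in\mathcal P_1$. For a fibered tripos $\mathcal X$ let $\mathcal X^{(1)}$ be the pullback of $\mathcal X$ along $M\mapsto(M\to1)$, and for $\varphi\in\mathcal X^{(1)}_M$ let $\gamma_{\mathcal X}(\varphi)$ be the greatest subobject $U\subseteq M$ such that $\top\le\overline\varphi|_U$, where $\overline\varphi$ is the reindexing of $\varphi$ to $\mathrm{id}_M$. For a tripos $(\mathcal P,\gamma)$ with $\gamma$ let $\mathcal X_{\mathcal P,\gamma}$ be the fibration on $\mathcal S\downarrow\mathcal S$ whose predicates on $m:M\to L$ are the predicates of $\mathcal P$ on $M$, with $\varphi\le\psi$ iff $\top\le\gamma(\forall_m(\varphi\Rightarrow\psi))$.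 **Theorem 4.12.10.** Over any topos $\mathcal S$, one-sorted uniform preorders with $\top,\wedge,\Rightarrow,\forall$, fibered triposes, and triposes with $\gamma$ are equivalent concepts. That is: 1. If $(A,R)$ is a one-sorted uniform preorder with $\top,\wedge,\Rightarrow,\forall$, then $\mathrm{ufam}(A,R)$ is a fibered tripos. 2. Every fibered tripos is equivalent to $\mathrm{ufam}(A,R)$ for some one-sorted uniform preorder $(A,R)$ with $\top,\wedge,\Rightarrow,\forall$. 3. For one-sorted uniform preorders, every fibered monotone map $\mathrm{ufam}(A,R)\to\mathrm{ufam}(B,Q)$ is isomorphic to $\mathrm{ufam}(f)$ (postcomposition with $f$) for a monotone map $f$; $f\le g$ iff $\mathrm{ufam}(f)\le\mathrm{ufam}(g)$; and $f$ is an equivalence iff $\mathrm{ufam}(f)$ is. 4. If $\mathcal X$ is a fibered tripos, then $(\mathcal X^{(1)},\gamma_{\mathcal X})$ is a tripos with $\gamma$, and $\mathcal X$ is equivalent to $\mathcal X_{\mathcal X^{(1)},\gamma_{\mathcal X}}$. 5. If $(\mathcal P,\gamma)$ is a tripos with $\gamma$, then $\mathcal X_{\mathcal P,\gamma}$ is a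 fibered tripos, and there is an equivalence $F:\mathcal P\to\mathcal X_{\mathcal P,\gamma}^{(1)}$ with $\gamma_{\mathcal X_{\mathcal P,\gamma}}\circ F=\gamma$. 6. For fibered triposes $\mathcal X,\mathcal Y$: every equivalence $F:\mathcal X\to\mathcal Y$ restricts to an equivalence $F^{(1)}:\mathcal X^{(1)}\to\mathcal Y^{(1)}$ with $\gamma_{\mathcal Y}\circ F^{(1)}=\gamma_{\mathcal X}$; every equivalence $H:\mathcal X^{(1)}\to\mathcal Y^{(1)}$ with $\gamma_{\mathcal Y}\circ H=\gamma_{\mathcal X}$ is isomorphic to $F^{(1)}$ for some equivalence $F$; and for all fibered monotone maps $F,G:\mathcal X\to\mathcal Y$, $F\le G$ iff $F^{(1)}\le G^{(1)}$. -/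

import Mathlib

open CategoryTheory Limits MonoidalCategory CartesianMonoidalCategory

universe w w₁ w₂ v v₁ u u₁

set_option linter.unusedSectionVars false

noncomputable section

namespace TriposTheory

/-! ### Posetal fibrations -/

section Fibrations

/-- A posetal fibration on `B`, i.e. a faithful fibration `p : |P| ⥤ B` with a cleavage, given by
the family of its objects over the objects of `B`. As `p` is faithful, there is at most one arrow
`φ ⟶ ψ` over a given `u`, and `Arr u φ ψ` says that there is one. `reindex u ψ` is the chosen
cartesian lifting of `ψ` along `u`. (See `Total`, `proj` and `ofFunctor` for the comparison with
fibrations as functors.) -/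
structure PosetalFibration (B : Type u) [Category.{v} B] where
  /-- the predicates on `I`, i.e. the objects of the total category over `I` -/
  Pred : B → Type w
  /-- there is an arrow `φ ⟶ ψ` over `u` -/
  Arr {I J : B} (u : I ⟶ J) (φ : Pred I) (ψ : Pred J) : Prop
  arr_id {I : B} (φ : Pred I) : Arr (𝟙 I) φ φ
  arr_comp {I J K : B} {u : I ⟶ J} {t : J ⟶ K} {φ : Pred I} {ψ : Pred J} {χ : Pred K} :
    Arr u φ ψ → Arr t ψ χ → Arr (u ≫ t) φ χ
  /-- the domain of the chosen cartesian arrow over `u` with codomain `ψ` -/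
  reindex {I J : B} (u : I ⟶ J) (ψ : Pred J) : Pred I
  arr_reindex {I J : B} (u : I ⟶ J) (ψ : Pred J) : Arr u (reindex u ψ) ψ
  /-- the chosen arrow is cartesian -/
  arr_cartesian {K I J : B} (t : K ⟶ I) (u : I ⟶ J) {χ : Pred K} {ψ : Pred J} :
    Arr (t ≫ u) χ ψ → Arr t χ (reindex u ψ)

namespace PosetalFibration

variable {B : Type u} [Category.{v} B]

/-- The fiber over `I`: there is a vertical arrow from `φ` to `ψ`. -/
instance (P : PosetalFibration.{w} B) (I : B) : Preorder (P.Pred I) where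
  le φ ψ := P.Arr (𝟙 I) φ ψ
  le_refl := P.arr_id
  le_trans _ _ _ h k := Category.comp_id (𝟙 I) ▸ P.arr_comp h k

variable (P : PosetalFibration.{w} B)

theorem arr_iff_le {I J : B} {u : I ⟶ J} {φ : P.Pred I} {ψ : P.Pred J} :
    P.Arr u φ ψ ↔ φ ≤ P.reindex u ψ :=
  ⟨fun h => P.arr_cartesian (𝟙 I) u ((Category.id_comp u).symm ▸ h),
    fun h => Category.id_comp u ▸ P.arr_comp h (P.arr_reindex u ψ)⟩

theorem reindex_mono {I J : B} (u : I ⟶ J) {φ ψ : P.Pred J} (h : φ ≤ ψ) :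
    P.reindex u φ ≤ P.reindex u ψ :=
  P.arr_iff_le.1 (by simpa using P.arr_comp (P.arr_reindex u φ) h)

theorem le_reindex_comp {I J K : B} (u : I ⟶ J) (t : J ⟶ K) (χ : P.Pred K) :
    P.reindex u (P.reindex t χ) ≤ P.reindex (u ≫ t) χ :=
  P.arr_iff_le.1 (P.arr_comp (P.arr_reindex u _) (P.arr_reindex t χ))

theorem reindex_comp_le {I J K : B} (u : I ⟶ J) (t : J ⟶ K) (χ : P.Pred K) :
    P.reindex (u ≫ t) χ ≤ P.reindex u (P.reindex t χ) :=
  P.arr_iff_le.1 (P.arr_cartesian u t (P.arr_reindex (u ≫ t) χ))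

theorem reindex_id_le {I : B} (φ : P.Pred I) : P.reindex (𝟙 I) φ ≤ φ :=
  P.arr_reindex (𝟙 I) φ

theorem le_reindex_id {I : B} (φ : P.Pred I) : φ ≤ P.reindex (𝟙 I) φ :=
  P.arr_iff_le.1 (P.arr_id φ)

/-- The posetal fibration given by preordered fibers and pseudofunctorial reindexing
(Grothendieck construction). -/
def ofIndexed (Pred : B → Type w) (le : ∀ {I : B}, Pred I → Pred I → Prop)
    (re : ∀ {I J : B}, (I ⟶ J) → Pred J → Pred I)
    (le_refl : ∀ {I : B} (φ : Pred I), le φ φ)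
    (le_trans : ∀ {I : B} {φ ψ χ : Pred I}, le φ ψ → le ψ χ → le φ χ)
    (re_mono : ∀ {I J : B} (u : I ⟶ J) {φ ψ : Pred J}, le φ ψ → le (re u φ) (re u ψ))
    (le_re_id : ∀ {I : B} (φ : Pred I), le φ (re (𝟙 I) φ))
    (le_re_comp : ∀ {I J K : B} (u : I ⟶ J) (t : J ⟶ K) (χ : Pred K),
      le (re u (re t χ)) (re (u ≫ t) χ))
    (re_comp_le : ∀ {I J K : B} (u : I ⟶ J) (t : J ⟶ K) (χ : Pred K),
      le (re (u ≫ t) χ) (re u (re t χ))) : PosetalFibration.{w} B where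
  Pred := Pred
  Arr u φ ψ := le φ (re u ψ)
  arr_id := le_re_id
  arr_comp h k := le_trans h (le_trans (re_mono _ k) (le_re_comp _ _ _))
  reindex := re
  arr_reindex _ _ := le_refl _
  arr_cartesian _ _ _ _ h := le_trans h (re_comp_le _ _ _)

/-- The total category of a posetal fibration. -/
structure Total where
  base : B
  pred : P.Pred base

instance : Category P.Total where
  Hom a b := { u : a.base ⟶ b.base // P.Arr u a.pred b.pred }
  id a := ⟨𝟙 a.base, P.arr_id a.pred⟩
  comp f g := ⟨f.1 ≫ g.1, P.arr_comp f.2 g.2⟩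

/-- The projection from the total category. -/
def proj : P.Total ⥤ B where
  obj a := a.base
  map f := f.1

instance : P.proj.Faithful where
  map_injective h := Subtype.ext h

instance : P.proj.IsFibered :=
  Functor.IsFibered.of_exists_isStronglyCartesian fun a R f => by
    let b : P.Total := ⟨R, P.reindex f a.pred⟩
    let φ : b ⟶ a := ⟨f, P.arr_reindex f a.pred⟩
    have : P.proj.IsHomLift f φ := inferInstanceAs (P.proj.IsHomLift (P.proj.map φ) φ)
    refine ⟨b, φ, { universal_property' := ?_ }⟩
    intro a' g φ' _
    have hφ : φ'.1 = g ≫ f := (IsHomLift.eq_of_isHomLift P.proj (g ≫ f) φ').symm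
    let χ : a' ⟶ b := ⟨g, P.arr_cartesian g f (hφ ▸ φ'.2)⟩
    refine ⟨χ, ⟨inferInstanceAs (P.proj.IsHomLift (P.proj.map χ) χ), Subtype.ext hφ.symm⟩, ?_⟩
    rintro χ' ⟨h', _⟩
    exact Subtype.ext (@IsHomLift.eq_of_isHomLift _ _ _ _ P.proj a' b g χ' h').symm

/-- A faithful fibration, as a functor, gives a posetal fibration. -/
def ofFunctor {E : Type w₁} [Category.{w₂} E] (p : E ⥤ B) [p.Faithful] [p.IsFibered] :
    PosetalFibration.{w₁} B where
  Pred I := p.Fiber I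
  Arr u φ ψ := ∃ f : φ.1 ⟶ ψ.1, p.IsHomLift u f
  arr_id φ := ⟨𝟙 _, IsHomLift.id φ.2⟩
  arr_comp := fun ⟨f, _⟩ ⟨g, _⟩ => ⟨f ≫ g, inferInstance⟩
  reindex u ψ := ⟨Functor.IsPreFibered.pullbackObj ψ.2 u,
    Functor.IsPreFibered.pullbackObj_proj ψ.2 u⟩
  arr_reindex u ψ := ⟨Functor.IsPreFibered.pullbackMap ψ.2 u, inferInstance⟩
  arr_cartesian t u _ ψ := fun ⟨f, _⟩ =>
    ⟨Functor.IsStronglyCartesian.map p u (Functor.IsPreFibered.pullbackMap ψ.2 u)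
      (rfl : t ≫ u = t ≫ u) f, inferInstance⟩

/-! Change of base, fibered monotone maps, equivalences -/

/-- The pullback of a posetal fibration along a functor. -/
def baseChange {C : Type u₁} [Category.{v₁} C] (F : C ⥤ B) : PosetalFibration.{w} C where
  Pred I := P.Pred (F.obj I)
  Arr u φ ψ := P.Arr (F.map u) φ ψ
  arr_id φ := (F.map_id _).symm ▸ P.arr_id φ
  arr_comp h k := (F.map_comp _ _).symm ▸ P.arr_comp h k
  reindex u ψ := P.reindex (F.map u) ψ
  arr_reindex u ψ := P.arr_reindex (F.map u) ψ
  arr_cartesian t u _ _ h := P.arr_cartesian (F.map t) (F.map u) (F.map_comp t u ▸ h)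

/-- A fibered functor between posetal fibrations (a fibered monotone map): a functor between the
total categories over `B` that preserves cartesian arrows. -/
structure FiberedMap (P : PosetalFibration.{w₁} B) (Q : PosetalFibration.{w₂} B) where
  app {I : B} : P.Pred I → Q.Pred I
  arr_app {I J : B} {u : I ⟶ J} {φ : P.Pred I} {ψ : P.Pred J} :
    P.Arr u φ ψ → Q.Arr u (app φ) (app ψ)
  app_cartesian {I J : B} (u : I ⟶ J) (ψ : P.Pred J) :
    Q.reindex u (app ψ) ≤ app (P.reindex u ψ)

namespace FiberedMap

variable {P : PosetalFibration.{w₁} B} {Q : PosetalFibration.{w₂} B}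

/-- There is a (necessarily unique) vertical natural transformation from `F` to `G`. -/
instance : Preorder (FiberedMap P Q) where
  le F G := ∀ ⦃I : B⦄ (φ : P.Pred I), F.app φ ≤ G.app φ
  le_refl _ _ _ := le_rfl
  le_trans _ _ _ h k _ φ := (h φ).trans (k φ)

/-- `F` is an equivalence of fibrations: it has a pseudo-inverse fibered functor. -/
def IsEquivalence (F : FiberedMap P Q) : Prop :=
  ∃ G : FiberedMap Q P,
    (∀ (I : B) (φ : P.Pred I), AntisymmRel (· ≤ ·) (G.app (F.app φ)) φ) ∧
    (∀ (I : B) (ψ : Q.Pred I), AntisymmRel (· ≤ ·) (F.app (G.app ψ)) ψ)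

/-- Change of base of a fibered functor. -/
def baseChange {C : Type u₁} [Category.{v₁} C] (F : FiberedMap P Q) (K : C ⥤ B) :
    FiberedMap (P.baseChange K) (Q.baseChange K) where
  app φ := F.app (I := K.obj _) φ
  arr_app h := F.arr_app h
  app_cartesian {I J} u ψ := by
    have h := F.app_cartesian (K.map u) ψ
    change Q.Arr (K.map (𝟙 I)) _ _
    rw [K.map_id]
    exact h

end FiberedMap

/-! First-order structure on posetal fibrations -/

/-- The fibers have finite meets, preserved by reindexing. -/
structure HasFiniteMeets (P : PosetalFibration.{w} B) : Prop where
  exists_top (I : B) : ∃ t : P.Pred I, IsTop t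
  top_reindex {I J : B} (u : I ⟶ J) {t : P.Pred J} : IsTop t → IsTop (P.reindex u t)
  exists_meet {I : B} (φ ψ : P.Pred I) : ∃ μ, IsGLB {φ, ψ} μ
  meet_reindex {I J : B} (u : I ⟶ J) {φ ψ μ : P.Pred J} :
    IsGLB {φ, ψ} μ → IsGLB {P.reindex u φ, P.reindex u ψ} (P.reindex u μ)

/-- The fibers have finite joins, preserved by reindexing. -/
structure HasFiniteJoins (P : PosetalFibration.{w} B) : Prop where
  exists_bot (I : B) : ∃ t : P.Pred I, IsBot t
  bot_reindex {I J : B} (u : I ⟶ J) {t : P.Pred J} : IsBot t → IsBot (P.reindex u t)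
  exists_join {I : B} (φ ψ : P.Pred I) : ∃ μ, IsLUB {φ, ψ} μ
  join_reindex {I J : B} (u : I ⟶ J) {φ ψ μ : P.Pred J} :
    IsLUB {φ, ψ} μ → IsLUB {P.reindex u φ, P.reindex u ψ} (P.reindex u μ)

/-- `c` is `φ ⇒ ψ`: for all `θ`, `θ ≤ c` iff `θ ∧ φ ≤ ψ`. -/
def IsImp {P : PosetalFibration.{w} B} {I : B} (φ ψ c : P.Pred I) : Prop :=
  ∀ θ μ : P.Pred I, IsGLB {θ, φ} μ → (θ ≤ c ↔ μ ≤ ψ)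

/-- The fibers have implication, preserved by reindexing. -/
structure HasImplication (P : PosetalFibration.{w} B) : Prop where
  exists_imp {I : B} (φ ψ : P.Pred I) : ∃ c, IsImp φ ψ c
  imp_reindex {I J : B} (u : I ⟶ J) {φ ψ c : P.Pred J} :
    IsImp φ ψ c → IsImp (P.reindex u φ) (P.reindex u ψ) (P.reindex u c)

/-- `q` is `∀_f ψ`, the value at `ψ` of the right adjoint to reindexing along `f`. -/
def IsForall {P : PosetalFibration.{w} B} {I J : B} (f : I ⟶ J) (ψ : P.Pred I) (q : P.Pred J) :
    Prop :=
  ∀ θ : P.Pred J, θ ≤ q ↔ P.reindex f θ ≤ ψ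

/-- `P` has universal quantification along the maps in `W`, subject to the Beck-Chevalley condition
for pullbacks along arbitrary maps. -/
structure HasForall (P : PosetalFibration.{w} B) (W : MorphismProperty B) : Prop where
  exists_forall {I J : B} (f : I ⟶ J) (hf : W f) (ψ : P.Pred I) : ∃ q, IsForall f ψ q
  beckChevalley {I J I' J' : B} {f : I ⟶ J} {f' : I' ⟶ J'} {u' : I' ⟶ I} {u : J' ⟶ J}
    (hf : W f) (sq : IsPullback u' f' f u) {ψ : P.Pred I} {q : P.Pred J} :
    IsForall f ψ q → IsForall f' (P.reindex u' ψ) (P.reindex u q)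

/-- Reindexing along the maps in `W` reflects the order (for `W` a class of covers, this says that
`P` is a pre-stack). -/
def IsPrestack (P : PosetalFibration.{w} B) (W : MorphismProperty B) : Prop :=
  ∀ ⦃I J : B⦄ (e : I ⟶ J), W e → ∀ φ ψ : P.Pred J, P.reindex e φ ≤ P.reindex e ψ → φ ≤ ψ

/-- `tr` is a generic predicate: every predicate is isomorphic to a reindexing of `tr`. -/
def IsGeneric {P : PosetalFibration.{w} B} {G : B} (tr : P.Pred G) : Prop :=
  ∀ ⦃I : B⦄ (φ : P.Pred I), ∃ f : I ⟶ G, AntisymmRel (· ≤ ·) φ (P.reindex f tr)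

end PosetalFibration

end Fibrations

/-! ### Power objects and images in a topos -/

section Subobjects

variable {S : Type u} [Category.{v} S] [HasPullbacks S]

theorem pullback_factors {X Y Z : S} (f : X ⟶ Y) (U : Subobject Y) (t : Z ⟶ X) :
    ((Subobject.pullback f).obj U).Factors t ↔ U.Factors (t ≫ f) := by
  have sq := Subobject.isPullback f U
  constructor
  · intro h
    rw [← Subobject.factorThru_arrow _ t h, Category.assoc, ← sq.w, ← Category.assoc]
    exact Subobject.factors_comp_arrow _
  · intro h
    rw [← sq.lift_snd (Subobject.factorThru _ _ h) t (Subobject.factorThru_arrow _ _ h)]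
    exact Subobject.factors_comp_arrow _

theorem le_iff_factors {Y : S} (U V : Subobject Y) :
    U ≤ V ↔ ∀ (Z : S) (t : Z ⟶ Y), U.Factors t → V.Factors t :=
  ⟨fun h _ t ht => Subobject.factors_of_le t h ht,
    fun h => Subobject.le_of_factors (h _ _ (Subobject.factors_self U))⟩

end Subobjects

section Topos

variable {S : Type u} [Category.{v} S] [CartesianMonoidalCategory S] [MonoidalClosed S]
  [HasFiniteLimits S] [HasSubobjectClassifier S]

/-- The power object of `A`. -/
def Pow (A : S) : S := (ihom A).obj (HasSubobjectClassifier.Ω S)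

/-- The name of a `T`-indexed family of subobjects of `A`. -/
def name {A T : S} (r : Subobject (A ⊗ T)) : T ⟶ Pow A :=
  MonoidalClosed.curry (HasSubobjectClassifier.χ r.arrow)

theorem chi_pullback {X Y : S} (f : X ⟶ Y) (r : Subobject Y) :
    HasSubobjectClassifier.χ ((Subobject.pullback f).obj r).arrow =
      f ≫ HasSubobjectClassifier.χ r.arrow := by
  symm
  exact (HasSubobjectClassifier.exists_classifier.some : Subobject.Classifier S).uniq _
    ((Subobject.isPullback f r).flip.paste_vert (HasSubobjectClassifier.isPullback_χ r.arrow))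

theorem comp_name {A T T' : S} (t : T' ⟶ T) (r : Subobject (A ⊗ T)) :
    t ≫ name r = name ((Subobject.pullback (A ◁ t)).obj r) := by
  unfold name
  rw [chi_pullback, MonoidalClosed.curry_natural_left]
  rfl

theorem name_injective {A T : S} : Function.Injective (name : Subobject (A ⊗ T) → (T ⟶ Pow A)) := by
  intro r s h
  have h := MonoidalClosed.curry_injective h
  exact ((HasSubobjectClassifier.exists_classifier.some :
    Subobject.Classifier S).representableBy.homEquiv.symm.injective h)

theorem name_surjective {A T : S} (f : T ⟶ Pow A) : ∃ r : Subobject (A ⊗ T), name r = f := by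
  obtain ⟨r, hr⟩ := (HasSubobjectClassifier.exists_classifier.some :
    Subobject.Classifier S).representableBy.homEquiv.symm.surjective (MonoidalClosed.uncurry f)
  refine ⟨r, ?_⟩
  rw [← MonoidalClosed.curry_uncurry f, ← hr]
  rfl


theorem eq_top_iff_factors {Y : S} (U : Subobject Y) :
    U = ⊤ ↔ ∀ (Z : S) (t : Z ⟶ Y), U.Factors t := by
  rw [eq_top_iff, le_iff_factors]
  exact ⟨fun h Z t => h Z t (Subobject.top_factors t), fun h Z t _ => h Z t⟩

theorem comp_name_eq_iff {A T T' : S} (t : T' ⟶ T) (r : Subobject (A ⊗ T)) :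
    t ≫ name r = t ≫ name ⊤ ↔
      ∀ (Z : S) (x : Z ⟶ A) (y : Z ⟶ T'), r.Factors (lift x (y ≫ t)) := by
  rw [comp_name, comp_name, name_injective.eq_iff, Subobject.pullback_top, eq_top_iff_factors]
  constructor
  · intro h Z x y
    simpa [pullback_factors] using h Z (lift x y)
  · intro h Z z
    rw [pullback_factors]
    have := h Z (z ≫ fst _ _) (z ≫ snd _ _)
    convert this using 1
    ext <;> simp

/-- Every morphism of a topos has an image. -/
theorem exists_image {X Y : S} (f : X ⟶ Y) : ∃ U : Subobject Y, U.Factors f ∧ ∀ V : Subobject Y, V.Factors f → U ≤ V := by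
  obtain ⟨e, he⟩ := name_surjective (𝟙 (Pow Y))
  let a : Pow Y ⟶ Pow X := name ((Subobject.pullback (f ▷ Pow Y)).obj e)
  let b : Pow Y ⟶ Pow X := name ⊤
  let k : equalizer a b ⟶ Pow Y := equalizer.ι a b
  let E : Subobject (equalizer a b ⊗ Y) :=
    (Subobject.pullback (lift (snd _ _) (fst _ _ ≫ k))).obj e
  have hE : ∀ {Z : S} (x : Z ⟶ equalizer a b) (y : Z ⟶ Y),
      E.Factors (lift x y) ↔ e.Factors (lift y (x ≫ k)) := by
    intro Z x y
    rw [pullback_factors]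
    simp
  refine ⟨equalizerSubobject (name E) (name ⊤), ?_, ?_⟩
  · rw [equalizerSubobject_factors_iff, comp_name_eq_iff]
    intro Z x y
    have h := (comp_name_eq_iff k ((Subobject.pullback (f ▷ Pow Y)).obj e)).1
      (equalizer.condition a b) Z y x
    rw [pullback_factors] at h
    rw [hE]
    simpa using h
  · intro U hU
    let U' : Subobject (Y ⊗ 𝟙_ S) := (Subobject.pullback (fst _ _)).obj U
    have hn : (Subobject.pullback (Y ◁ name U')).obj e = U' := by
      apply name_injective
      rw [← comp_name, he, Category.comp_id]
    have hmem : ∀ {Z : S} (y : Z ⟶ Y), e.Factors (lift y (toUnit Z ≫ name U')) ↔ U.Factors y := by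
      intro Z y
      have : U'.Factors (lift y (toUnit Z)) ↔ U.Factors y := by
        rw [pullback_factors]; simp
      rw [← this]
      conv_rhs => rw [← hn, pullback_factors]
      simp
    have hk : name U' ≫ a = name U' ≫ b := by
      refine (comp_name_eq_iff (name U') _).2 fun Z x y => ?_
      rw [pullback_factors, toUnit_unique y (toUnit Z)]
      have := (hmem (x ≫ f)).2 (Subobject.factors_of_factors_right x hU)
      simpa using this
    rw [le_iff_factors]
    intro Z t ht
    rw [equalizerSubobject_factors_iff, comp_name_eq_iff] at ht
    have := ht Z (toUnit Z ≫ equalizer.lift (name U') hk) (𝟙 Z)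
    rw [hE] at this
    rw [← hmem]
    simpa [k] using this
/-- The image of a morphism: the least subobject of the codomain through which it factors. -/
def image {X Y : S} (f : X ⟶ Y) : Subobject Y := (exists_image f).choose

theorem image_factors {X Y : S} (f : X ⟶ Y) : (image f).Factors f := (exists_image f).choose_spec.1

theorem image_le {X Y : S} {f : X ⟶ Y} {V : Subobject Y} (h : V.Factors f) : image f ≤ V :=
  (exists_image f).choose_spec.2 V h

end Topos

/-! ### Fibrations on `S` and on `S ↓ S` -/

section Base

variable {S : Type u} [Category.{v} S]

/-- The fibration of subobjects. -/
def sub (S : Type u) [Category.{v} S] [HasPullbacks S] : PosetalFibration S :=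
  PosetalFibration.ofIndexed (fun I => Subobject I) (fun U V => U ≤ V)
    (fun u U => (Subobject.pullback u).obj U) (fun _ => le_rfl) (fun h k => h.trans k)
    (fun u _ _ h => (Subobject.pullback u).monotone h)
    (fun U => (Subobject.pullback_id U).ge)
    (fun u t U => (Subobject.pullback_comp u t U).ge)
    (fun u t U => (Subobject.pullback_comp u t U).le)

theorem sub_le_iff [HasPullbacks S] {I : S} {U V : Subobject I} :
    (show (sub S).Pred I from U) ≤ (show (sub S).Pred I from V) ↔ U ≤ V := by
  change U ≤ (Subobject.pullback (𝟙 I)).obj V ↔ U ≤ V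
  rw [Subobject.pullback_id]

theorem sub_isTop_iff [HasPullbacks S] {I : S} {U : Subobject I} :
    IsTop (show (sub S).Pred I from U) ↔ U = ⊤ :=
  ⟨fun h => top_le_iff.1 (sub_le_iff.1 (h (⊤ : Subobject I))),
    fun h _ => sub_le_iff.2 (h ▸ le_top)⟩

/-- The vertical maps of the fundamental fibration `cod : S ↓ S ⥤ S`. -/
inductive Vertical : MorphismProperty (Arrow S)
  | intro {M N L : S} (e : M ⟶ N) (n : N ⟶ L) :
      Vertical (Arrow.homMk e (𝟙 L) : Arrow.mk (e ≫ n) ⟶ Arrow.mk n)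

/-- The cartesian map of the fundamental fibration over `t : T ⟶ L` with codomain `m : M ⟶ L`. -/
def cartesianMap [HasPullbacks S] (m : Arrow S) {T : S} (t : T ⟶ m.right) :
    Arrow.mk (pullback.snd m.hom t) ⟶ m :=
  Arrow.homMk (pullback.fst m.hom t) t pullback.condition

/-- The functor `M ↦ (M ⟶ 1)`. -/
def toTerminal (S : Type u) [Category.{v} S] [CartesianMonoidalCategory S] : S ⥤ Arrow S where
  obj M := Arrow.mk (toUnit M)
  map f := Arrow.homMk f (𝟙 _)

/-- The map `(M = M) ⟶ (M ⟶ 1)` given by the identity of `M`. -/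
def idToTerminal [CartesianMonoidalCategory S] (M : S) :
    Arrow.mk (𝟙 M) ⟶ (toTerminal S).obj M :=
  Arrow.homMk (𝟙 M) (toUnit M)

/-- The order of a fibered posetal fibration is horizontally definable: for `φ`, `ψ` over
`m : M ⟶ L` there is a subobject `U` of `L` such that a map `t : T ⟶ L` factors through `U` if and
only if the restrictions of `φ` and `ψ` along `t` satisfy `t^* φ ≤ t^* ψ`. -/
def HorizontallyDefinable [HasPullbacks S] (X : PosetalFibration.{w} (Arrow S)) : Prop :=
  ∀ ⦃m : Arrow S⦄ (φ ψ : X.Pred m), ∃ U : Subobject m.right, ∀ ⦃T : S⦄ (t : T ⟶ m.right),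
    U.Factors t ↔ X.reindex (cartesianMap m t) φ ≤ X.reindex (cartesianMap m t) ψ

end Base

/-! ### Fibered triposes and triposes with `γ` -/

section Triposes

variable {S : Type u} [Category.{v} S] [CartesianMonoidalCategory S] [HasFiniteLimits S]

open PosetalFibration

/-- Fibered triposes on `S`. -/
structure IsFiberedTripos (X : PosetalFibration.{w} (Arrow S)) : Prop where
  prestack : X.IsPrestack (Vertical ⊓ MorphismProperty.epimorphisms (Arrow S))
  definable : HorizontallyDefinable X
  meets : X.HasFiniteMeets
  joins : X.HasFiniteJoins
  implication : X.HasImplication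
  forall_vertical : X.HasForall Vertical
  generic : ∃ (G : S) (tr : X.Pred ((toTerminal S).obj G)), IsGeneric tr

/-- `(P, γ)` is a tripos with `γ` on `S`. -/
structure IsTriposWithGamma (P : PosetalFibration.{w} S) (γ : FiberedMap P (sub S)) : Prop where
  prestack : P.IsPrestack (MorphismProperty.regularEpi S)
  meets : P.HasFiniteMeets
  implication : P.HasImplication
  forall_all : P.HasForall ⊤
  generic : ∃ (G : S) (tr : P.Pred G), IsGeneric tr
  gamma_top {I : S} {t : P.Pred I} : IsTop t → IsTop (γ.app t)
  gamma_meet {I : S} {φ ψ μ : P.Pred I} : IsGLB {φ, ψ} μ → IsGLB {γ.app φ, γ.app ψ} (γ.app μ)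
  gamma_reflects {p : P.Pred (𝟙_ S)} : IsTop (γ.app p) → IsTop p

/-- `X⁽¹⁾`: the restriction of a fibered posetal fibration to the objects `M ⟶ 1`. -/
def fiberOne (X : PosetalFibration.{w} (Arrow S)) : PosetalFibration.{w} S :=
  X.baseChange (toTerminal S)

section Gamma

variable (X : PosetalFibration.{w} (Arrow S)) (hd : HorizontallyDefinable X)
  (hm : X.HasFiniteMeets)

/-- For `φ` over `M ⟶ 1`, the greatest subobject `U` of `M` such that `⊤ ≤ φ'|_U`, where `φ'` is
the reindexing of `φ` to `M = M`. -/
def gammaApp {M : S} (φ : (fiberOne X).Pred M) : Subobject M :=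
  (hd (m := Arrow.mk (𝟙 M)) (hm.exists_top _).choose (X.reindex (idToTerminal M) φ)).choose

theorem gammaApp_factors {M T : S} (φ : (fiberOne X).Pred M) (t : T ⟶ M) :
    (gammaApp X hd hm φ).Factors t ↔
      IsTop (X.reindex (I := Arrow.mk (𝟙 T)) (J := (toTerminal S).obj M)
        (idToTerminal T ≫ (toTerminal S).map t) φ) := by
  have spec := (hd (m := Arrow.mk (𝟙 M)) (hm.exists_top _).choose
    (X.reindex (idToTerminal M) φ)).choose_spec t
  have top := hm.top_reindex (cartesianMap (Arrow.mk (𝟙 M)) t) (hm.exists_top _).choose_spec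
  have toTop {m : Arrow S} {χ ψ : X.Pred m} (h : IsTop χ) (hle : χ ≤ ψ) : IsTop ψ :=
    fun θ => (h θ).trans hle
  let a : Arrow.mk (𝟙 T) ⟶ Arrow.mk (Limits.pullback.snd (Arrow.mk (𝟙 M)).hom t) :=
    Arrow.homMk (Limits.pullback.lift t (𝟙 T) (by simp)) (𝟙 T)
      (by simpa using Limits.pullback.lift_snd _ _ _)
  let b : Arrow.mk (Limits.pullback.snd (Arrow.mk (𝟙 M)).hom t) ⟶ Arrow.mk (𝟙 T) :=
    Arrow.homMk (Limits.pullback.snd (Arrow.mk (𝟙 M)).hom t) (𝟙 T) (by simp)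
  have ha : a ≫ cartesianMap (Arrow.mk (𝟙 M)) t ≫ idToTerminal M =
      idToTerminal T ≫ (toTerminal S).map t := by
    ext
    · change Limits.pullback.lift t (𝟙 T) _ ≫ Limits.pullback.fst (𝟙 M) t ≫ 𝟙 M = 𝟙 T ≫ t
      rw [Limits.pullback.lift_fst_assoc, Category.comp_id, Category.id_comp]
    · exact toUnit_unique _ _
  have hb : b ≫ idToTerminal T ≫ (toTerminal S).map t =
      cartesianMap (Arrow.mk (𝟙 M)) t ≫ idToTerminal M := by
    ext
    · change Limits.pullback.snd (𝟙 M) t ≫ 𝟙 T ≫ t = Limits.pullback.fst (𝟙 M) t ≫ 𝟙 M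
      rw [Limits.pullback.condition, Category.id_comp]
    · exact toUnit_unique _ _
  refine spec.trans ⟨fun h => ?_, fun h => ?_⟩
  · have h1 := hm.top_reindex a (toTop top (h.trans (X.le_reindex_comp _ _ _)))
    rw [← ha]
    exact toTop h1 (X.le_reindex_comp _ _ _)
  · have h1 := toTop (hm.top_reindex b h) (X.le_reindex_comp _ _ _)
    rw [hb] at h1
    exact toTop h1 (X.reindex_comp_le _ _ _) _

/-- The fibered monotone map `γ : X⁽¹⁾ ⟶ sub S`. -/
def gamma : FiberedMap (fiberOne X) (sub S) where
  app φ := gammaApp X hd hm φ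
  arr_app {I J u φ ψ} h := by
    change gammaApp X hd hm φ ≤ (Subobject.pullback u).obj (gammaApp X hd hm ψ)
    rw [le_iff_factors]
    intro T t ht
    rw [gammaApp_factors] at ht
    rw [pullback_factors, gammaApp_factors, Functor.map_comp, ← Category.assoc]
    have h' : X.Arr ((toTerminal S).map u) φ ψ := h
    have h'' := X.reindex_mono (idToTerminal T ≫ (toTerminal S).map t) (X.arr_iff_le.1 h')
    exact fun θ => ((ht θ).trans h'').trans (X.le_reindex_comp _ _ _)
  app_cartesian {I J} u ψ := by
    refine sub_le_iff.2 ?_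
    change (Subobject.pullback u).obj (gammaApp X hd hm ψ) ≤ gammaApp X hd hm _
    rw [le_iff_factors]
    intro T t ht
    rw [pullback_factors, gammaApp_factors, Functor.map_comp, ← Category.assoc] at ht
    rw [gammaApp_factors]
    exact fun θ => (ht θ).trans (X.reindex_comp_le _ _ _)

end Gamma

section OfGamma

variable (P : PosetalFibration.{w} S) (γ : FiberedMap P (sub S))

/-- `φ ≤ ψ` over `m : M ⟶ L` if and only if `⊤ ≤ γ (∀_m (φ ⇒ ψ))`. -/
def LEOver {M L : S} (m : M ⟶ L) (φ ψ : P.Pred M) : Prop :=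
  ∃ (c : P.Pred M) (q : P.Pred L), IsImp φ ψ c ∧ IsForall m c q ∧ IsTop (γ.app q)

variable {P γ}

theorem leOver_of_le (h : IsTriposWithGamma P γ) {M L : S} (m : M ⟶ L) {φ ψ : P.Pred M} (hle : φ ≤ ψ) :
    LEOver P γ m φ ψ := by
  obtain ⟨c, hc⟩ := h.implication.exists_imp φ ψ
  obtain ⟨q, hq⟩ := h.forall_all.exists_forall m trivial c
  refine ⟨c, q, hc, hq, h.gamma_top fun θ => (hq θ).2 ?_⟩
  obtain ⟨μ, hμ⟩ := h.meets.exists_meet (P.reindex m θ) φ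
  exact (hc _ μ hμ).2 ((hμ.1 (by simp)).trans hle)

theorem leOver_trans (h : IsTriposWithGamma P γ) {M L : S} (m : M ⟶ L) {φ ψ χ : P.Pred M} :
    LEOver P γ m φ ψ → LEOver P γ m ψ χ → LEOver P γ m φ χ := by
  rintro ⟨c, q, hc, hq, ht⟩ ⟨c', q', hc', hq', ht'⟩
  obtain ⟨c₃, hc₃⟩ := h.implication.exists_imp φ χ
  obtain ⟨q₃, hq₃⟩ := h.forall_all.exists_forall m trivial c₃
  obtain ⟨μ, hμ⟩ := h.meets.exists_meet q q'
  have mp {φ ψ c ν : P.Pred M} (hc : IsImp φ ψ c) (h₁ : ν ≤ c) (h₂ : ν ≤ φ) : ν ≤ ψ := by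
    obtain ⟨κ, hκ⟩ := h.meets.exists_meet c φ
    refine le_trans (hκ.2 ?_) ((hc c κ hκ).1 le_rfl)
    rintro x (rfl | rfl)
    exacts [h₁, h₂]
  have hle : μ ≤ q₃ := by
    refine (hq₃ μ).2 ?_
    obtain ⟨ν, hν⟩ := h.meets.exists_meet (P.reindex m μ) φ
    refine (hc₃ _ ν hν).2 (mp hc' ?_ (mp hc ?_ (hν.1 (by simp))))
    · exact (hν.1 (by simp)).trans
        ((P.reindex_mono m (hμ.1 (by simp))).trans ((hq' q').1 le_rfl))
    · exact (hν.1 (by simp)).trans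
        ((P.reindex_mono m (hμ.1 (by simp))).trans ((hq q).1 le_rfl))
  refine ⟨c₃, q₃, hc₃, hq₃, fun θ => le_trans ((h.gamma_meet hμ).2 ?_) (γ.arr_app hle)⟩
  rintro x (rfl | rfl)
  exacts [ht _, ht' _]

theorem leOver_reindex (h : IsTriposWithGamma P γ) {M L M' L' : S} {m : M ⟶ L} {m' : M' ⟶ L'} (u : M' ⟶ M) (k : L' ⟶ L)
    (w : u ≫ m = m' ≫ k) {φ ψ : P.Pred M} :
    LEOver P γ m φ ψ → LEOver P γ m' (P.reindex u φ) (P.reindex u ψ) := by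
  rintro ⟨c, q, hc, hq, ht⟩
  obtain ⟨q', hq'⟩ := h.forall_all.exists_forall m' trivial (P.reindex u c)
  have hle : P.reindex k q ≤ q' := by
    refine (hq' _).2 ((P.le_reindex_comp m' k q).trans ?_)
    rw [← w]
    exact (P.reindex_comp_le u m q).trans (P.reindex_mono u ((hq q).1 le_rfl))
  have htop : IsTop ((sub S).reindex k (γ.app q)) := by
    refine sub_isTop_iff.2 ?_
    change (Subobject.pullback k).obj (γ.app q) = ⊤
    have ht' : γ.app q = (⊤ : Subobject L) := sub_isTop_iff.1 ht
    exact ht' ▸ Subobject.pullback_top k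
  exact ⟨_, q', h.implication.imp_reindex u hc, hq',
    fun θ => ((htop θ).trans (γ.app_cartesian k q)).trans (γ.arr_app hle)⟩

end OfGamma

/-- The fibered posetal fibration of a tripos with `γ`: the predicates on `m : M ⟶ L` are the
predicates of `P` on `M`, with `φ ≤ ψ` if and only if `⊤ ≤ γ (∀_m (φ ⇒ ψ))`. -/
def ofGamma {P : PosetalFibration.{w} S} {γ : FiberedMap P (sub S)} (h : IsTriposWithGamma P γ) :
    PosetalFibration.{w} (Arrow S) :=
  PosetalFibration.ofIndexed (fun m => P.Pred m.left) (fun {m} φ ψ => LEOver P γ m.hom φ ψ)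
    (fun u φ => P.reindex u.left φ) (fun _ => leOver_of_le h _ le_rfl)
    (fun h₁ h₂ => leOver_trans h _ h₁ h₂) (fun u _ _ h' => leOver_reindex h u.left u.right u.w h')
    (fun φ => leOver_of_le h _ (P.le_reindex_id φ))
    (fun u t χ => leOver_of_le h _ (P.le_reindex_comp u.left t.left χ))
    (fun u t χ => leOver_of_le h _ (P.reindex_comp_le u.left t.left χ))

end Triposes

/-! ### One-sorted internal uniform preorders -/

section Uniform

variable {S : Type u} [Category.{v} S] [CartesianMonoidalCategory S] [MonoidalClosed S]
  [HasFiniteLimits S] [HasSubobjectClassifier S]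

/-- The projections from `(A × A × A) × T`, the last factor being a parameter. -/
def proj₁₂ (A T : S) : (A ⊗ A ⊗ A) ⊗ T ⟶ (A ⊗ A) ⊗ T :=
  lift (lift (fst _ _ ≫ fst _ _) (fst _ _ ≫ snd _ _ ≫ fst _ _)) (snd _ _)

/-- See `proj₁₂`. -/
def proj₂₃ (A T : S) : (A ⊗ A ⊗ A) ⊗ T ⟶ (A ⊗ A) ⊗ T :=
  lift (fst _ _ ≫ snd _ _) (snd _ _)

/-- See `proj₁₂`. -/
def proj₁₃ (A T : S) : (A ⊗ A ⊗ A) ⊗ T ⟶ (A ⊗ A) ⊗ T :=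
  lift (lift (fst _ _ ≫ fst _ _) (fst _ _ ≫ snd _ _ ≫ snd _ _)) (snd _ _)

/-- The composite `{(a, c) | ∃ b, r(a, b) ∧ s(b, c)}` of two `T`-indexed families of relations. -/
def relComp {A T : S} (r s : Subobject ((A ⊗ A) ⊗ T)) : Subobject ((A ⊗ A) ⊗ T) :=
  image (((Subobject.pullback (proj₁₂ A T)).obj r ⊓ (Subobject.pullback (proj₂₃ A T)).obj s).arrow ≫
    proj₁₃ A T)

/-- For `m : M ⟶ L` and `φ, ψ : M ⟶ A`, the `L`-indexed family of relations
`{(φ x, ψ x) | x ∈ M_l}`. -/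
def graphOver {A M L : S} (m : M ⟶ L) (φ ψ : M ⟶ A) : Subobject ((A ⊗ A) ⊗ L) :=
  image (lift (lift φ ψ) m)

theorem graphOver_factors {A M L Z : S} (m : M ⟶ L) (φ ψ : M ⟶ A) (x : Z ⟶ M) :
    (graphOver m φ ψ).Factors (lift (lift (x ≫ φ) (x ≫ ψ)) (x ≫ m)) := by
  have h := Subobject.factors_of_factors_right x (image_factors (lift (lift φ ψ) m))
  rwa [comp_lift, comp_lift] at h

variable (S) in
/-- A one-sorted uniform preorder `(A, R)` internal to `S`: an object `A` with a subobject `R` of the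
object `P(A × A)` of relations which is downward closed, contains the identity relation and is
closed under composition, in the internal logic of `S` (the axioms are written out at all stages
`T`, a `T`-indexed family `r` of relations being in `R` if its name `T ⟶ P(A × A)` factors through
`R`). -/
structure UniformPreorder where
  carrier : S
  rel : Subobject (Pow (carrier ⊗ carrier))
  down {T : S} (r s : Subobject ((carrier ⊗ carrier) ⊗ T)) :
    s ≤ r → rel.Factors (name r) → rel.Factors (name s)
  refl : rel.Factors (name (graphOver (toUnit carrier) (𝟙 carrier) (𝟙 carrier)))
  comp {T : S} (r s : Subobject ((carrier ⊗ carrier) ⊗ T)) :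
    rel.Factors (name r) → rel.Factors (name s) → rel.Factors (name (relComp r s))

namespace UniformPreorder

open PosetalFibration

/-- `φ ≤ ψ` over `m : M ⟶ L`: `∀ l : L, {(φ x, ψ x) | x ∈ M_l} ∈ R` in the internal logic. -/
def LEOver (𝔄 : UniformPreorder S) {M L : S} (m : M ⟶ L) (φ ψ : M ⟶ 𝔄.carrier) : Prop :=
  𝔄.rel.Factors (name (graphOver m φ ψ))

theorem leOver_refl (𝔄 : UniformPreorder S) {M L : S} (m : M ⟶ L) (φ : M ⟶ 𝔄.carrier) :
    𝔄.LEOver m φ φ := by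
  have h := Subobject.factors_of_factors_right (toUnit L) 𝔄.refl
  rw [comp_name] at h
  refine 𝔄.down _ _ (image_le ?_) h
  rw [pullback_factors]
  simpa using graphOver_factors (toUnit 𝔄.carrier) (𝟙 𝔄.carrier) (𝟙 𝔄.carrier) φ

theorem leOver_trans (𝔄 : UniformPreorder S) {M L : S} (m : M ⟶ L) {φ ψ χ : M ⟶ 𝔄.carrier} :
    𝔄.LEOver m φ ψ → 𝔄.LEOver m ψ χ → 𝔄.LEOver m φ χ := by
  intro h k
  refine 𝔄.down _ _ (image_le ?_) (𝔄.comp _ _ h k)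
  let t : M ⟶ (𝔄.carrier ⊗ 𝔄.carrier ⊗ 𝔄.carrier) ⊗ L := lift (lift φ (lift ψ χ)) m
  have ht : ((Subobject.pullback (proj₁₂ 𝔄.carrier L)).obj (graphOver m φ ψ) ⊓
      (Subobject.pullback (proj₂₃ 𝔄.carrier L)).obj (graphOver m ψ χ)).Factors t := by
    rw [Subobject.inf_factors, pullback_factors, pullback_factors]
    constructor
    · simpa [t, proj₁₂] using graphOver_factors m φ ψ (𝟙 M)
    · simpa [t, proj₂₃] using graphOver_factors m ψ χ (𝟙 M)
  have h' := Subobject.factors_of_factors_right (Subobject.factorThru _ t ht)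
    (image_factors (((Subobject.pullback (proj₁₂ 𝔄.carrier L)).obj (graphOver m φ ψ) ⊓
      (Subobject.pullback (proj₂₃ 𝔄.carrier L)).obj (graphOver m ψ χ)).arrow ≫
        proj₁₃ 𝔄.carrier L))
  rw [Subobject.factorThru_arrow_assoc] at h'
  have e : t ≫ proj₁₃ 𝔄.carrier L = lift (lift φ χ) m := by simp [t, proj₁₃]
  exact e ▸ h'

theorem leOver_reindex (𝔄 : UniformPreorder S) {M L M' L' : S} {m : M ⟶ L} {m' : M' ⟶ L'}
    (u : M' ⟶ M) (k : L' ⟶ L) (w : u ≫ m = m' ≫ k) {φ ψ : M ⟶ 𝔄.carrier} :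
    𝔄.LEOver m φ ψ → 𝔄.LEOver m' (u ≫ φ) (u ≫ ψ) := by
  intro h
  have h := Subobject.factors_of_factors_right k h
  rw [comp_name] at h
  refine 𝔄.down _ _ (image_le ?_) h
  rw [pullback_factors]
  simpa [w] using graphOver_factors m φ ψ u

/-- The fibered posetal fibration of a one-sorted uniform preorder: the predicates on `m : M ⟶ L`
are the maps `M ⟶ A`. -/
def ufam (𝔄 : UniformPreorder S) : PosetalFibration.{v} (Arrow S) :=
  PosetalFibration.ofIndexed (fun m => m.left ⟶ 𝔄.carrier) (fun {m} φ ψ => 𝔄.LEOver m.hom φ ψ)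
    (fun u φ => u.left ≫ φ) (fun φ => 𝔄.leOver_refl _ φ) (fun h k => 𝔄.leOver_trans _ h k)
    (fun u _ _ h => 𝔄.leOver_reindex u.left u.right u.w h)
    (fun φ => by simpa using 𝔄.leOver_refl _ φ)
    (fun u t χ => by simpa using 𝔄.leOver_refl _ ((u ≫ t).left ≫ χ))
    (fun u t χ => by simpa using 𝔄.leOver_refl _ ((u ≫ t).left ≫ χ))

/-- The uniform preorder has `⊤`, `∧`, `⇒` and `∀`. -/
structure HasLogic (𝔄 : UniformPreorder S) : Prop where
  meets : 𝔄.ufam.HasFiniteMeets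
  implication : 𝔄.ufam.HasImplication
  forall_vertical : 𝔄.ufam.HasForall Vertical

/-- A monotone map of uniform preorders: `r ∈ R` implies `(f × f)(r) ∈ R'`, in the internal
logic. -/
structure MonotoneMap (𝔄 𝔅 : UniformPreorder S) where
  hom : 𝔄.carrier ⟶ 𝔅.carrier
  monotone {T : S} (r : Subobject ((𝔄.carrier ⊗ 𝔄.carrier) ⊗ T)) :
    𝔄.rel.Factors (name r) → 𝔅.rel.Factors (name (image (r.arrow ≫ ((hom ⊗ₘ hom) ▷ T))))

namespace MonotoneMap

variable {𝔄 𝔅 : UniformPreorder S}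

/-- `f ≤ g` if and only if `{(f a, g a) | a ∈ A} ∈ R'`. -/
instance : Preorder (MonotoneMap 𝔄 𝔅) where
  le f g := 𝔅.LEOver (toUnit 𝔄.carrier) f.hom g.hom
  le_refl f := 𝔅.leOver_refl _ f.hom
  le_trans _ _ _ h k := 𝔅.leOver_trans _ h k

/-- `f` is an equivalence in the locally ordered category of uniform preorders. -/
def IsEquivalence (f : MonotoneMap 𝔄 𝔅) : Prop :=
  ∃ g : MonotoneMap 𝔅 𝔄,
    (𝔄.LEOver (toUnit 𝔄.carrier) (f.hom ≫ g.hom) (𝟙 _) ∧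
      𝔄.LEOver (toUnit 𝔄.carrier) (𝟙 _) (f.hom ≫ g.hom)) ∧
    (𝔅.LEOver (toUnit 𝔅.carrier) (g.hom ≫ f.hom) (𝟙 _) ∧
      𝔅.LEOver (toUnit 𝔅.carrier) (𝟙 _) (g.hom ≫ f.hom))

theorem leOver_comp (f : MonotoneMap 𝔄 𝔅) {M L : S} (m : M ⟶ L) {φ ψ : M ⟶ 𝔄.carrier}
    (h : 𝔄.LEOver m φ ψ) : 𝔅.LEOver m (φ ≫ f.hom) (ψ ≫ f.hom) := by
  refine 𝔅.down _ _ (image_le ?_) (f.monotone _ h)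
  have h' := Subobject.factors_of_factors_right
    (Subobject.factorThru (graphOver m φ ψ) _ (image_factors (lift (lift φ ψ) m)))
    (image_factors ((graphOver m φ ψ).arrow ≫ ((f.hom ⊗ₘ f.hom) ▷ L)))
  have e := Subobject.factorThru_arrow (graphOver m φ ψ) _ (image_factors (lift (lift φ ψ) m))
  rw [← Category.assoc, e] at h'
  simpa using h'

/-- The fibered functor induced by a monotone map, given by postcomposition. -/
def ufam (f : MonotoneMap 𝔄 𝔅) : FiberedMap 𝔄.ufam 𝔅.ufam where
  app {m} φ := CategoryStruct.comp (X := m.left) (Y := 𝔄.carrier) φ f.hom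
  arr_app {m m' u φ ψ} h := by
    have aux {M M' L : S} (m : M ⟶ L) (u : M ⟶ M') (φ : M ⟶ 𝔄.carrier) (ψ : M' ⟶ 𝔄.carrier)
        (h : 𝔄.LEOver m φ (u ≫ ψ)) : 𝔅.LEOver m (φ ≫ f.hom) (u ≫ ψ ≫ f.hom) := by
      simpa using f.leOver_comp m h
    exact aux m.hom u.left φ ψ h
  app_cartesian {m m'} u ψ := by
    have aux {M M' L : S} (m : M ⟶ L) (u : M ⟶ M') (ψ : M' ⟶ 𝔄.carrier) :
        𝔅.LEOver m (u ≫ ψ ≫ f.hom) (𝟙 M ≫ (u ≫ ψ) ≫ f.hom) := by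
      simpa using 𝔅.leOver_refl m (u ≫ ψ ≫ f.hom)
    exact aux m.hom u.left ψ

end MonotoneMap

end UniformPreorder

end Uniform

end TriposTheory

end

set_option linter.unusedSectionVars false

/-! A generic predicate over an object `G ⟶ 1` turns every predicate over `M ⟶ L` into a map `M ⟶
G`. A fibered tripos is therefore determined by `G` and by the knowledge of which families of pairs
`(a, b)` of elements of `G` satisfy `a ≤ b`. The universal family of pairs is the membership
relation over `Pow (G ⊗ G)`. Horizontal definability, applied to it, cuts out the subobject `R`
(`exists_rel_of_definable`), and the pre-stack condition makes the order depend only on the image of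
a family of pairs (`genLE_graphOver_iff`). Conversely, the order of `ufam` is defined through
images, which do not change under precomposition with epimorphisms (`graphOver_epi_comp`) and are
stable under pullback (`pullback_graphOver`). These two facts give the pre-stack condition and
definability. Disjunctions come for free from the second-order encoding over the generic predicate
(`hasFiniteJoins_of_isGeneric`). A fibered map out of `ufam` is determined, as in the Yoneda lemma,
by its value at the identity of the carrier (`exists_ufam`).

For `γ`, let `φ` and `ψ` be predicates over `M ⟶ 1` and `m : M ⟶ L`. By the Beck-Chevalley
condition, `φ ≤ ψ` holds after restriction to `m` if and only if `∀_m (φ ⇒ ψ)` becomes true over `L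
= L`, i.e. has `γ` equal to `⊤` (`leOver_fiberOne_iff`). So the fiber over `1` together with `γ`
remembers the order over all objects of `S ↓ S`. In the other direction, the predicates `p` with `γ
p = ⊤` form filters stable under reindexing, and the order defined from `γ` over `m : M ⟶ L` is
entailment under a hypothesis `p` over `L` from this filter (`leOver_iff_exists`). Hence `⊤`, `∧`,
`⇒` and vertical `∀` can be computed in `P`. Over `M ⟶ 1` the hypothesis disappears because `γ`
reflects truth over `1` (`leOver_toUnit_iff`), and over `M = M` truth means `γ = ⊤`
(`ofGamma_isTop_id_iff`), so that `P` and `γ` are recovered.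

Equivalences transfer because the order over `m` is expressed by `⇒`, `∀` and `γ` alone
(`leOver_app_iff`), and inequalities of fibered maps can be tested at the generic predicate
(`le_iff_baseChange_le`). Throughout, connectives are characterized only up to isomorphism, and
equivalences are handled through their fiberwise description `IsFiberwiseEquiv`. -/

noncomputable section

namespace TriposTheory

/-! ### Epimorphisms, images and families of relations in a topos -/

section ToposLemmas

variable {S : Type u} [Category.{v} S] [CartesianMonoidalCategory S] [MonoidalClosed S]
  [HasFiniteLimits S] [HasSubobjectClassifier S]

/-- Pulling back a subobject is precomposing its classifying map, and an epimorphism can be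
cancelled there. -/
theorem pullback_injective_of_epi {X Y : S} (e : X ⟶ Y) [Epi e] :
    Function.Injective (Subobject.pullback e).obj := by
  intro U V h
  have h' : HasSubobjectClassifier.χ U.arrow = HasSubobjectClassifier.χ V.arrow := by
    rw [← cancel_epi e, ← chi_pullback, ← chi_pullback, h]
  exact (HasSubobjectClassifier.exists_classifier.some :
    Subobject.Classifier S).representableBy.homEquiv.symm.injective h'

theorem le_of_pullback_le_of_epi {X Y : S} (e : X ⟶ Y) [Epi e] {U V : Subobject Y}
    (h : (Subobject.pullback e).obj U ≤ (Subobject.pullback e).obj V) : U ≤ V := by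
  rw [← inf_eq_left]
  apply pullback_injective_of_epi e
  rw [Subobject.inf_pullback, inf_eq_left]
  exact h

theorem factors_of_epi_comp {X Y Z : S} (e : X ⟶ Y) [Epi e] {U : Subobject Z} {z : Y ⟶ Z}
    (h : U.Factors (e ≫ z)) : U.Factors z := by
  have h₁ : (⊤ : Subobject Y) ≤ (Subobject.pullback z).obj U := by
    refine le_of_pullback_le_of_epi e ((le_iff_factors _ _).2 fun T t _ => ?_)
    rw [pullback_factors, pullback_factors, Category.assoc]
    exact Subobject.factors_of_factors_right t h
  have h₂ := (le_iff_factors _ _).1 h₁ Y (𝟙 Y) (Subobject.top_factors _)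
  rwa [pullback_factors, Category.id_comp] at h₂

/-- Two maps that agree after `f` have an equalizer through which `f` factors. -/
theorem epi_of_subobject {X Y : S} (f : X ⟶ Y)
    (h : ∀ V : Subobject Y, V.Factors f → V.Factors (𝟙 Y)) : Epi f where
  left_cancellation g k hgk := by
    have := h (equalizerSubobject g k) (by rwa [equalizerSubobject_factors_iff])
    rw [equalizerSubobject_factors_iff] at this
    simpa using this

theorem mk_factors_iff_exists {X Y Z : S} (m : X ⟶ Y) [Mono m] (z : Z ⟶ Y) :
    (Subobject.mk m).Factors z ↔ ∃ g : Z ⟶ X, g ≫ m = z :=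
  Subobject.mk_factors_iff m z

/-- A subobject of the image that still receives `X` is also a subobject of `Y` through which `f`
factors, so by minimality it is the whole image. -/
theorem epi_factorThru_image {X Y : S} (f : X ⟶ Y) :
    Epi ((image f).factorThru f (image_factors f)) := by
  refine epi_of_subobject _ fun V hV => ?_
  have h : image f ≤ Subobject.mk (V.arrow ≫ (image f).arrow) := by
    refine image_le ((mk_factors_iff_exists _ _).2 ⟨V.factorThru _ hV, ?_⟩)
    simp [← Category.assoc]
  have h' := (le_iff_factors _ _).1 h _ _ (Subobject.factors_self _)
  obtain ⟨g, hg⟩ := (mk_factors_iff_exists _ _).1 h'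
  have : g ≫ V.arrow = 𝟙 _ := by
    rw [← cancel_mono (image f).arrow]
    rw [Category.assoc, hg, Category.id_comp]
  exact this ▸ Subobject.factors_comp_arrow g

/-- Cartesian closedness enters here: `Y' ⊗ -` is a left adjoint and so preserves the epimorphism
`e`, and pullback along `t` is reduced to this case by regarding `Y'` as the graph of `t` inside `Y'
⊗ Y`. -/
theorem epi_of_isPullback {X Y X' Y' : S} {t' : X' ⟶ X} {e' : X' ⟶ Y'} {e : X ⟶ Y} {t : Y' ⟶ Y}
    (sq : IsPullback t' e' e t) [Epi e] : Epi e' := by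
  refine epi_of_subobject _ fun V hV => ?_
  have : Mono (lift (𝟙 Y') t) := mono_of_mono_fac (lift_fst (𝟙 Y') t)
  have : Epi (Y' ◁ e) := inferInstanceAs (Epi ((tensorLeft Y').map e))
  -- After pulling back along `Y' ◁ e`, a point of the graph is a pair `(y', x)` with `t y' = e x`.
  -- It comes from a point of `X'`, so `y'` lies in every subobject `V` that contains the values of
  -- `e'`.
  have h : Subobject.mk (lift (𝟙 Y') t) ≤ Subobject.mk (V.arrow ≫ lift (𝟙 Y') t) := by
    refine le_of_pullback_le_of_epi (Y' ◁ e) ((le_iff_factors _ _).2 fun Z z hz => ?_)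
    rw [pullback_factors] at hz ⊢
    obtain ⟨g, hg⟩ := (mk_factors_iff_exists _ _).1 hz
    have h₁ : g = z ≫ fst _ _ := by simpa using hg =≫ fst _ _
    have h₂ : g ≫ t = (z ≫ snd _ _) ≫ e := by simpa using hg =≫ snd _ _
    have hgV : V.Factors g := by
      rw [← sq.lift_snd (z ≫ snd _ _) g h₂.symm]
      exact Subobject.factors_of_factors_right _ hV
    refine (mk_factors_iff_exists _ _).2 ⟨V.factorThru g hgV, ?_⟩
    rw [← hg]
    rw [← Category.assoc, Subobject.factorThru_arrow]
  have h' := (le_iff_factors _ _).1 h _ _ (Subobject.mk_factors_self _)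
  obtain ⟨g, hg⟩ := (mk_factors_iff_exists _ _).1 h'
  have : g ≫ V.arrow = 𝟙 _ := by simpa using hg =≫ fst _ _
  exact this ▸ Subobject.factors_comp_arrow g

/-- The Kripke-Joyal reading of an image: a preimage of `z` exists after passing to a cover, namely
the pullback of the epimorphism from `X` onto the image. -/
theorem image_factors_iff {X Y Z : S} (f : X ⟶ Y) (z : Z ⟶ Y) :
    (image f).Factors z ↔ ∃ (Z' : S) (e : Z' ⟶ Z) (_ : Epi e) (x : Z' ⟶ X), x ≫ f = e ≫ z := by
  constructor
  · intro h
    have := epi_factorThru_image f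
    let p := (image f).factorThru f (image_factors f)
    let q := (image f).factorThru z h
    refine ⟨_, pullback.snd p q, epi_of_isPullback (IsPullback.of_hasPullback p q),
      pullback.fst p q, ?_⟩
    have := pullback.condition (f := p) (g := q) =≫ (image f).arrow
    simpa [p, q] using this
  · rintro ⟨Z', e, _, x, h⟩
    refine factors_of_epi_comp e ?_
    rw [← h]
    exact Subobject.factors_of_factors_right x (image_factors f)

/-- If `g` coequalizes the kernel pair of `e`, the image of `(e, g)` is the graph of a map on `Y`,
and this map is the factorization of `g`. The lemma is needed because the pre-stack condition of a
tripos with `γ` refers to regular epimorphisms and that of a fibered tripos to all of them. -/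
theorem isRegularEpi_of_epi {X Y : S} (e : X ⟶ Y) [Epi e] : IsRegularEpi e := by
  refine IsRegularEpi.of_epi_of_exists fun Z g hg => ?_
  let G := image (lift e g)
  let k := G.factorThru (lift e g) (image_factors _)
  have hk : k ≫ G.arrow = lift e g := Subobject.factorThru_arrow _ _ _
  have : Epi (G.arrow ≫ fst Y Z) := by
    have : k ≫ G.arrow ≫ fst Y Z = e := by rw [reassoc_of% hk, lift_fst]
    have : Epi (k ≫ G.arrow ≫ fst Y Z) := this ▸ inferInstance
    exact epi_of_epi k _
  -- The relation is single-valued: locally, two points with the same first coordinate come from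
  -- points of `X` identified by `e`, hence by `g`.
  have : Mono (G.arrow ≫ fst Y Z) := by
    refine ⟨fun {T} a b hab => ?_⟩
    obtain ⟨T₁, c₁, _, x, hx⟩ := (image_factors_iff (lift e g) (a ≫ G.arrow)).1
      (Subobject.factors_comp_arrow a)
    obtain ⟨T₂, c₂, _, y, hy⟩ := (image_factors_iff (lift e g) (c₁ ≫ b ≫ G.arrow)).1
      (Subobject.factors_of_factors_right c₁ (Subobject.factors_comp_arrow b))
    have hx₁ := hx =≫ fst _ _
    have hx₂ := hx =≫ snd _ _
    have hy₁ := hy =≫ fst _ _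
    have hy₂ := hy =≫ snd _ _
    simp only [Category.assoc, lift_fst, lift_snd] at hx₁ hx₂ hy₁ hy₂ hab
    have hxy : (c₂ ≫ x) ≫ e = y ≫ e := by rw [Category.assoc, hx₁, hy₁, hab]
    have hxy' : (c₂ ≫ x) ≫ g = y ≫ g := by
      rw [← pullback.lift_fst (c₂ ≫ x) y hxy, Category.assoc, hg, pullback.lift_snd_assoc]
    rw [← cancel_epi (c₂ ≫ c₁), ← cancel_mono G.arrow]
    ext
    · simp [hab]
    · simpa [← hx₂, ← hy₂] using hxy'
  have := isIso_of_mono_of_epi (G.arrow ≫ fst Y Z)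
  refine ⟨inv (G.arrow ≫ fst Y Z) ≫ G.arrow ≫ snd Y Z, ?_⟩
  have h₁ : e = k ≫ G.arrow ≫ fst Y Z := by rw [reassoc_of% hk, lift_fst]
  conv_lhs => rw [h₁]
  simp only [Category.assoc, IsIso.hom_inv_id_assoc]
  rw [← Category.assoc, hk, lift_snd]

theorem subobject_ext_factors {Y : S} {U V : Subobject Y}
    (h : ∀ (Z : S) (z : Z ⟶ Y), U.Factors z ↔ V.Factors z) : U = V :=
  le_antisymm ((le_iff_factors _ _).2 fun Z z => (h Z z).1)
    ((le_iff_factors _ _).2 fun Z z => (h Z z).2)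

theorem image_epi_comp {X' X Y : S} (e : X' ⟶ X) [Epi e] (f : X ⟶ Y) : image (e ≫ f) = image f :=
  le_antisymm (image_le (Subobject.factors_of_factors_right e (image_factors f)))
    (image_le (factors_of_epi_comp e (image_factors (e ≫ f))))

theorem image_arrow {Y : S} (U : Subobject Y) : image U.arrow = U :=
  le_antisymm (image_le (Subobject.factors_self U)) (Subobject.le_of_factors (image_factors _))

theorem graphOver_epi_comp {A M N L : S} (e : M ⟶ N) [Epi e] (n : N ⟶ L) (φ ψ : N ⟶ A) :
    graphOver (e ≫ n) (e ≫ φ) (e ≫ ψ) = graphOver n φ ψ := by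
  unfold graphOver
  rw [← comp_lift, ← comp_lift, image_epi_comp]

/-- Every family of relations is the family traced out by its own two coordinate maps, so statements
about `r` can be read as statements about predicates on `r`. -/
theorem graphOver_arrow {A T : S} (r : Subobject ((A ⊗ A) ⊗ T)) :
    graphOver (r.arrow ≫ snd _ _) (r.arrow ≫ fst _ _ ≫ fst _ _) (r.arrow ≫ fst _ _ ≫ snd _ _) =
      r := by
  unfold graphOver
  conv_rhs => rw [← image_arrow r]
  congr 1
  ext <;> simp

/-- Pullback stability of images, in the form that gives horizontal definability of `ufam`. -/
theorem pullback_graphOver {A M L M' L' : S} {t' : M' ⟶ M} {m' : M' ⟶ L'} {m : M ⟶ L}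
    {t : L' ⟶ L} (sq : IsPullback t' m' m t) (φ ψ : M ⟶ A) :
    (Subobject.pullback ((A ⊗ A) ◁ t)).obj (graphOver m φ ψ) =
      graphOver m' (t' ≫ φ) (t' ≫ ψ) := by
  refine subobject_ext_factors fun Z z => ?_
  rw [pullback_factors]
  unfold graphOver
  constructor
  · intro h
    obtain ⟨Z', e, _, x, h⟩ := (image_factors_iff _ _).1 h
    have h₁ := h =≫ fst _ _
    have h₂ : x ≫ m = (e ≫ z ≫ snd _ _) ≫ t := by simpa using h =≫ snd _ _
    refine (image_factors_iff _ _).2 ⟨Z', e, inferInstance, sq.lift _ _ h₂, ?_⟩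
    apply CartesianMonoidalCategory.hom_ext
    · simpa [comp_lift, -tensor_whiskerLeft] using h₁
    · simp
  · intro h
    obtain ⟨Z', e, _, x, h⟩ := (image_factors_iff _ _).1 h
    have h₁ := h =≫ fst _ _
    have h₂ : x ≫ m' = e ≫ z ≫ snd _ _ := by simpa using h =≫ snd _ _
    refine (image_factors_iff _ _).2 ⟨Z', e, inferInstance, x ≫ t', ?_⟩
    apply CartesianMonoidalCategory.hom_ext
    · simpa [comp_lift, -tensor_whiskerLeft] using h₁
    · simp [sq.w, reassoc_of% h₂]

end ToposLemmas

/-! ### Meets, joins and tops in preorders -/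

section OrderLemmas

variable {α : Type u} [Preorder α]

theorem isGLB_pair_iff {a b m : α} : IsGLB {a, b} m ↔ ∀ x, x ≤ m ↔ x ≤ a ∧ x ≤ b := by
  rw [isGLB_iff_le_iff]
  simp [lowerBounds]

theorem isLUB_pair_iff {a b m : α} : IsLUB {a, b} m ↔ ∀ x, m ≤ x ↔ a ≤ x ∧ b ≤ x := by
  rw [isLUB_iff_le_iff]
  simp [upperBounds]

theorem isGLB_pair_congr {a b m a' b' m' : α} (ha : AntisymmRel (· ≤ ·) a a')
    (hb : AntisymmRel (· ≤ ·) b b') (hm : AntisymmRel (· ≤ ·) m m') (h : IsGLB {a, b} m) :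
    IsGLB {a', b'} m' := by
  rw [isGLB_pair_iff] at h ⊢
  intro x
  rw [← hm.le_congr_right, ← ha.le_congr_right, ← hb.le_congr_right, h]

theorem isLUB_pair_congr {a b m a' b' m' : α} (ha : AntisymmRel (· ≤ ·) a a')
    (hb : AntisymmRel (· ≤ ·) b b') (hm : AntisymmRel (· ≤ ·) m m') (h : IsLUB {a, b} m) :
    IsLUB {a', b'} m' := by
  rw [isLUB_pair_iff] at h ⊢
  intro x
  rw [← hm.le_congr_left, ← ha.le_congr_left, ← hb.le_congr_left, h]

theorem isGLB_pair_antisymmRel {a b m m' : α} (h : IsGLB {a, b} m) (h' : IsGLB {a, b} m') :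
    AntisymmRel (· ≤ ·) m m' :=
  ⟨h'.2 h.1, h.2 h'.1⟩

theorem isTop_of_le {a b : α} (ha : IsTop a) (h : a ≤ b) : IsTop b :=
  fun x => (ha x).trans h

end OrderLemmas

/-! ### Connectives up to isomorphism and fiberwise equivalences -/

namespace PosetalFibration

variable {B : Type u} [Category.{v} B] (P : PosetalFibration.{w} B)

theorem reindex_congr {I J : B} (u : I ⟶ J) {φ ψ : P.Pred J} (h : AntisymmRel (· ≤ ·) φ ψ) :
    AntisymmRel (· ≤ ·) (P.reindex u φ) (P.reindex u ψ) :=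
  ⟨P.reindex_mono u h.1, P.reindex_mono u h.2⟩

theorem reindex_comp {I J K : B} (u : I ⟶ J) (t : J ⟶ K) (χ : P.Pred K) :
    AntisymmRel (· ≤ ·) (P.reindex u (P.reindex t χ)) (P.reindex (u ≫ t) χ) :=
  ⟨P.le_reindex_comp u t χ, P.reindex_comp_le u t χ⟩

theorem reindex_id {I : B} (φ : P.Pred I) : AntisymmRel (· ≤ ·) (P.reindex (𝟙 I) φ) φ :=
  ⟨P.reindex_id_le φ, P.le_reindex_id φ⟩

/-- Both ways around a commutative square, reindexing gives isomorphic predicates. -/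
theorem reindex_square {I J J' K : B} {u : I ⟶ J} {t : J ⟶ K} {u' : I ⟶ J'} {t' : J' ⟶ K}
    (h : u ≫ t = u' ≫ t') (χ : P.Pred K) :
    AntisymmRel (· ≤ ·) (P.reindex u (P.reindex t χ)) (P.reindex u' (P.reindex t' χ)) :=
  (P.reindex_comp u t χ).trans (h ▸ (P.reindex_comp u' t' χ).symm)

variable {P}

theorem HasFiniteMeets.isTop_reindex_iso_iff (hm : P.HasFiniteMeets) {I J : B} (e : I ≅ J)
    (φ : P.Pred J) : IsTop (P.reindex e.hom φ) ↔ IsTop φ := by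
  refine ⟨fun h => ?_, hm.top_reindex _⟩
  refine isTop_of_le (hm.top_reindex e.inv h) ((P.le_reindex_comp _ _ _).trans ?_)
  rw [e.inv_hom_id]
  exact P.reindex_id_le φ

/-! Implication -/

/-- Quantifying over all common lower bounds `χ` makes it unnecessary to name a meet; later
arguments then become plain entailments under hypotheses. -/
theorem isImp_iff (hm : P.HasFiniteMeets) {I : B} {φ ψ c : P.Pred I} :
    IsImp φ ψ c ↔ ∀ θ, θ ≤ c ↔ ∀ χ, χ ≤ θ → χ ≤ φ → χ ≤ ψ := by
  have aux {θ μ : P.Pred I} (h : IsGLB {θ, φ} μ) : μ ≤ ψ ↔ ∀ χ, χ ≤ θ → χ ≤ φ → χ ≤ ψ := by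
    rw [isGLB_pair_iff] at h
    exact ⟨fun hle χ h₁ h₂ => ((h χ).2 ⟨h₁, h₂⟩).trans hle,
      fun hχ => hχ μ ((h μ).1 le_rfl).1 ((h μ).1 le_rfl).2⟩
  constructor
  · intro h θ
    obtain ⟨μ, hμ⟩ := hm.exists_meet θ φ
    rw [h θ μ hμ, aux hμ]
  · intro h θ μ hμ
    rw [h, aux hμ]

theorem IsImp.mp (hm : P.HasFiniteMeets) {I : B} {φ ψ c χ : P.Pred I} (h : IsImp φ ψ c)
    (h₁ : χ ≤ c) (h₂ : χ ≤ φ) : χ ≤ ψ :=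
  ((isImp_iff hm).1 h χ).1 h₁ χ le_rfl h₂

theorem IsImp.intro (hm : P.HasFiniteMeets) {I : B} {φ ψ c θ : P.Pred I} (h : IsImp φ ψ c)
    (h₁ : ∀ χ, χ ≤ θ → χ ≤ φ → χ ≤ ψ) : θ ≤ c :=
  ((isImp_iff hm).1 h θ).2 h₁

theorem IsImp.isTop_iff (hm : P.HasFiniteMeets) {I : B} {φ ψ c : P.Pred I} (h : IsImp φ ψ c) :
    IsTop c ↔ φ ≤ ψ :=
  ⟨fun hc => h.mp hm (hc φ) le_rfl, fun hle _ => h.intro hm fun _ _ h₂ => h₂.trans hle⟩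

theorem IsImp.congr {I : B} {φ ψ c φ' ψ' c' : P.Pred I} (hφ : AntisymmRel (· ≤ ·) φ φ')
    (hψ : AntisymmRel (· ≤ ·) ψ ψ') (hc : AntisymmRel (· ≤ ·) c c') (h : IsImp φ ψ c) :
    IsImp φ' ψ' c' := by
  intro θ μ hμ
  rw [← hc.le_congr_right, ← hψ.le_congr_right]
  exact h θ μ (isGLB_pair_congr (.refl _ _) hφ.symm (.refl _ _) hμ)

theorem IsImp.antisymmRel (hm : P.HasFiniteMeets) {I : B} {φ ψ c c' : P.Pred I}
    (h : IsImp φ ψ c) (h' : IsImp φ ψ c') : AntisymmRel (· ≤ ·) c c' :=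
  ⟨h'.intro hm fun _ h₁ h₂ => h.mp hm h₁ h₂, h.intro hm fun _ h₁ h₂ => h'.mp hm h₁ h₂⟩

/-! Universal quantification -/

theorem IsForall.congr {I J : B} {f : I ⟶ J} {ψ ψ' : P.Pred I} {q q' : P.Pred J}
    (hψ : AntisymmRel (· ≤ ·) ψ ψ') (hq : AntisymmRel (· ≤ ·) q q') (h : IsForall f ψ q) :
    IsForall f ψ' q' := by
  intro θ
  rw [← hq.le_congr_right, ← hψ.le_congr_right, h]

theorem IsForall.mono {I J : B} {f : I ⟶ J} {ψ ψ' : P.Pred I} {q q' : P.Pred J}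
    (h : IsForall f ψ q) (h' : IsForall f ψ' q') (hle : ψ ≤ ψ') : q ≤ q' :=
  (h' q).2 (((h q).1 le_rfl).trans hle)

theorem IsForall.antisymmRel {I J : B} {f : I ⟶ J} {ψ : P.Pred I} {q q' : P.Pred J}
    (h : IsForall f ψ q) (h' : IsForall f ψ q') : AntisymmRel (· ≤ ·) q q' :=
  ⟨h.mono h' le_rfl, h'.mono h le_rfl⟩

theorem IsForall.isTop_iff (hm : P.HasFiniteMeets) {I J : B} {f : I ⟶ J} {ψ : P.Pred I}
    {q : P.Pred J} (h : IsForall f ψ q) : IsTop q ↔ IsTop ψ :=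
  ⟨fun hq => isTop_of_le (hm.top_reindex f hq) ((h q).1 le_rfl),
    fun hψ _ => (h _).2 (hψ _)⟩

/-- Meets need only be exhibited up to isomorphism, together with their stability. -/
theorem HasFiniteMeets.mk_of_exists
    (top : ∀ I : B, ∃ t : P.Pred I, IsTop t)
    (top_reindex : ∀ {I J : B} (u : I ⟶ J) {t : P.Pred J}, IsTop t → IsTop (P.reindex u t))
    (meet : ∀ {J : B} (φ ψ : P.Pred J), ∃ μ, IsGLB {φ, ψ} μ ∧
      ∀ {I : B} (u : I ⟶ J), IsGLB {P.reindex u φ, P.reindex u ψ} (P.reindex u μ)) :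
    P.HasFiniteMeets where
  exists_top := top
  top_reindex := top_reindex
  exists_meet φ ψ := (meet φ ψ).imp fun _ h => h.1
  meet_reindex u φ ψ μ h := by
    obtain ⟨μ', h₁, h₂⟩ := meet φ ψ
    exact isGLB_pair_congr (.refl _ _) (.refl _ _)
      (P.reindex_congr u (isGLB_pair_antisymmRel h₁ h)) (h₂ u)

namespace FiberedMap

variable {P : PosetalFibration.{w₁} B} {Q : PosetalFibration.{w₂} B} (F : FiberedMap P Q)

theorem mono {I : B} {φ ψ : P.Pred I} (h : φ ≤ ψ) : F.app φ ≤ F.app ψ :=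
  F.arr_app h

theorem congr {I : B} {φ ψ : P.Pred I} (h : AntisymmRel (· ≤ ·) φ ψ) :
    AntisymmRel (· ≤ ·) (F.app φ) (F.app ψ) :=
  ⟨F.mono h.1, F.mono h.2⟩

theorem app_reindex {I J : B} (u : I ⟶ J) (ψ : P.Pred J) :
    AntisymmRel (· ≤ ·) (F.app (P.reindex u ψ)) (Q.reindex u (F.app ψ)) :=
  ⟨Q.arr_iff_le.1 (F.arr_app (P.arr_reindex u ψ)), F.app_cartesian u ψ⟩

/-- A fibered map given by monotone maps on the fibers that commute with reindexing. -/
def ofMono (app : ∀ {I : B}, P.Pred I → Q.Pred I)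
    (mono : ∀ {I : B} {φ ψ : P.Pred I}, φ ≤ ψ → app φ ≤ app ψ)
    (app_reindex : ∀ {I J : B} (u : I ⟶ J) (ψ : P.Pred J),
      AntisymmRel (· ≤ ·) (app (P.reindex u ψ)) (Q.reindex u (app ψ))) : FiberedMap P Q where
  app := app
  arr_app h := Q.arr_iff_le.2 ((mono (P.arr_iff_le.1 h)).trans (app_reindex _ _).1)
  app_cartesian u ψ := (app_reindex u ψ).2

/-- The composite of fibered monotone maps. -/
def comp {R : PosetalFibration.{w} B} (F : FiberedMap P Q) (G : FiberedMap Q R) :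
    FiberedMap P R :=
  ofMono (fun φ => G.app (F.app φ)) (fun h => G.mono (F.mono h))
    fun u ψ => (G.congr (F.app_reindex u ψ)).trans (G.app_reindex u (F.app ψ))

/-- `F` reflects the order of the fibers and is surjective on them up to isomorphism. -/
structure IsFiberwiseEquiv : Prop where
  reflects {I : B} {φ ψ : P.Pred I} : F.app φ ≤ F.app ψ → φ ≤ ψ
  surj {I : B} (ψ : Q.Pred I) : ∃ φ : P.Pred I, AntisymmRel (· ≤ ·) (F.app φ) ψ

variable {F}

theorem IsFiberwiseEquiv.le_iff (h : F.IsFiberwiseEquiv) {I : B} {φ ψ : P.Pred I} :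
    F.app φ ≤ F.app ψ ↔ φ ≤ ψ :=
  ⟨h.reflects, F.mono⟩

theorem IsFiberwiseEquiv.antisymmRel_iff (h : F.IsFiberwiseEquiv) {I : B} {φ ψ : P.Pred I} :
    AntisymmRel (· ≤ ·) (F.app φ) (F.app ψ) ↔ AntisymmRel (· ≤ ·) φ ψ :=
  and_congr h.le_iff h.le_iff

/-- The pseudo-inverse of a fiberwise equivalence. -/
def IsFiberwiseEquiv.inverse (h : F.IsFiberwiseEquiv) : FiberedMap Q P :=
  ofMono (fun ψ => (h.surj ψ).choose)
    (fun {_ φ ψ} hle => h.reflects (((h.surj φ).choose_spec.1.trans hle).trans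
      (h.surj ψ).choose_spec.2))
    fun u ψ => h.antisymmRel_iff.1 (((h.surj _).choose_spec.trans
      (Q.reindex_congr u (h.surj ψ).choose_spec.symm)).trans (F.app_reindex u _).symm)

theorem IsFiberwiseEquiv.app_inverse (h : F.IsFiberwiseEquiv) {I : B} (ψ : Q.Pred I) :
    AntisymmRel (· ≤ ·) (F.app (h.inverse.app ψ)) ψ :=
  (h.surj ψ).choose_spec

theorem IsFiberwiseEquiv.inverse_app (h : F.IsFiberwiseEquiv) {I : B} (φ : P.Pred I) :
    AntisymmRel (· ≤ ·) (h.inverse.app (F.app φ)) φ :=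
  h.antisymmRel_iff.1 (h.app_inverse _)

/-- Preimages chosen fiber by fiber already form a fibered map: reflection of the order makes the
choice monotone, and it commutes with reindexing because `F` does. -/
theorem isEquivalence_iff : F.IsEquivalence ↔ F.IsFiberwiseEquiv := by
  constructor
  · rintro ⟨G, h₁, h₂⟩
    exact ⟨fun {I φ ψ} h => ((h₁ I φ).2.trans (G.mono h)).trans (h₁ I ψ).1,
      fun {I} ψ => ⟨G.app ψ, h₂ I ψ⟩⟩
  · exact fun h => ⟨h.inverse, fun _ => h.inverse_app, fun _ => h.app_inverse⟩

theorem IsFiberwiseEquiv.inverse_isFiberwiseEquiv (h : F.IsFiberwiseEquiv) :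
    h.inverse.IsFiberwiseEquiv :=
  isEquivalence_iff.1 ⟨F, fun _ => h.app_inverse, fun _ => h.inverse_app⟩

theorem IsFiberwiseEquiv.comp {R : PosetalFibration.{w} B} {G : FiberedMap Q R}
    (hF : F.IsFiberwiseEquiv) (hG : G.IsFiberwiseEquiv) : (F.comp G).IsFiberwiseEquiv where
  reflects h := hF.reflects (hG.reflects h)
  surj χ := by
    obtain ⟨ψ, hψ⟩ := hG.surj χ
    obtain ⟨φ, hφ⟩ := hF.surj ψ
    exact ⟨φ, (G.congr hφ).trans hψ⟩

theorem IsFiberwiseEquiv.isTop_iff (h : F.IsFiberwiseEquiv) {I : B} {φ : P.Pred I} :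
    IsTop (F.app φ) ↔ IsTop φ := by
  constructor
  · exact fun ht ψ => h.reflects (ht _)
  · intro ht ψ
    obtain ⟨ψ', hψ⟩ := h.surj ψ
    exact hψ.2.trans (F.mono (ht ψ'))

theorem IsFiberwiseEquiv.isGLB_iff (h : F.IsFiberwiseEquiv) {I : B} {φ ψ μ : P.Pred I} :
    IsGLB {F.app φ, F.app ψ} (F.app μ) ↔ IsGLB {φ, ψ} μ := by
  rw [isGLB_pair_iff, isGLB_pair_iff]
  constructor
  · intro hg x
    rw [← h.le_iff, hg, h.le_iff, h.le_iff]
  · intro hg y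
    obtain ⟨x, hx⟩ := h.surj y
    rw [← hx.le_congr_left, ← hx.le_congr_left, ← hx.le_congr_left, h.le_iff, hg, h.le_iff,
      h.le_iff]

theorem IsFiberwiseEquiv.isImp_iff (h : F.IsFiberwiseEquiv) {I : B} {φ ψ c : P.Pred I} :
    IsImp (F.app φ) (F.app ψ) (F.app c) ↔ IsImp φ ψ c := by
  constructor
  · intro hi θ μ hμ
    rw [← h.le_iff, hi _ _ (h.isGLB_iff.2 hμ), h.le_iff]
  · intro hi θ μ hμ
    obtain ⟨θ', hθ⟩ := h.surj θ
    obtain ⟨μ', hμ'⟩ := h.surj μ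
    rw [← hθ.le_congr_left, ← hμ'.le_congr_left, h.le_iff, h.le_iff]
    exact hi _ _ (h.isGLB_iff.1 (isGLB_pair_congr hθ.symm (.refl _ _) hμ'.symm hμ))

theorem IsFiberwiseEquiv.isForall_iff (h : F.IsFiberwiseEquiv) {I J : B} {f : I ⟶ J}
    {ψ : P.Pred I} {q : P.Pred J} : IsForall f (F.app ψ) (F.app q) ↔ IsForall f ψ q := by
  constructor
  · intro hq θ
    rw [← h.le_iff, hq, ← (F.app_reindex f θ).le_congr_left, h.le_iff]
  · intro hq θ
    obtain ⟨θ', hθ⟩ := h.surj θ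
    rw [← hθ.le_congr_left, ← (Q.reindex_congr f hθ).le_congr_left,
      ← (F.app_reindex f θ').le_congr_left, h.le_iff, h.le_iff, hq]

theorem IsFiberwiseEquiv.hasFiniteMeets (h : F.IsFiberwiseEquiv) (hQ : Q.HasFiniteMeets) :
    P.HasFiniteMeets where
  exists_top I := by
    obtain ⟨t, ht⟩ := hQ.exists_top I
    obtain ⟨t', ht'⟩ := h.surj t
    exact ⟨t', h.isTop_iff.1 (isTop_of_le ht ht'.2)⟩
  top_reindex u t ht := h.isTop_iff.1
    (isTop_of_le (hQ.top_reindex u (h.isTop_iff.2 ht)) (F.app_reindex u t).2)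
  exists_meet φ ψ := by
    obtain ⟨μ, hμ⟩ := hQ.exists_meet (F.app φ) (F.app ψ)
    obtain ⟨μ', hμ'⟩ := h.surj μ
    exact ⟨μ', h.isGLB_iff.1 (isGLB_pair_congr (.refl _ _) (.refl _ _) hμ'.symm hμ)⟩
  meet_reindex u φ ψ μ hμ := h.isGLB_iff.1 (isGLB_pair_congr (F.app_reindex u φ).symm
    (F.app_reindex u ψ).symm (F.app_reindex u μ).symm (hQ.meet_reindex u (h.isGLB_iff.2 hμ)))

theorem IsFiberwiseEquiv.hasImplication (h : F.IsFiberwiseEquiv) (hQ : Q.HasImplication) :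
    P.HasImplication where
  exists_imp φ ψ := by
    obtain ⟨c, hc⟩ := hQ.exists_imp (F.app φ) (F.app ψ)
    obtain ⟨c', hc'⟩ := h.surj c
    exact ⟨c', h.isImp_iff.1 (hc.congr (.refl _ _) (.refl _ _) hc'.symm)⟩
  imp_reindex u φ ψ c hc := h.isImp_iff.1 ((hQ.imp_reindex u (h.isImp_iff.2 hc)).congr
    (F.app_reindex u φ).symm (F.app_reindex u ψ).symm (F.app_reindex u c).symm)

theorem IsFiberwiseEquiv.hasForall (h : F.IsFiberwiseEquiv) {W : MorphismProperty B}
    (hQ : Q.HasForall W) : P.HasForall W where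
  exists_forall f hf ψ := by
    obtain ⟨q, hq⟩ := hQ.exists_forall f hf (F.app ψ)
    obtain ⟨q', hq'⟩ := h.surj q
    exact ⟨q', h.isForall_iff.1 (hq.congr (.refl _ _) hq'.symm)⟩
  beckChevalley {_ _ _ _ f f' u' u} hf sq ψ q hq := h.isForall_iff.1
    ((hQ.beckChevalley hf sq (h.isForall_iff.2 hq)).congr
      (F.app_reindex u' ψ).symm (F.app_reindex u q).symm)

end FiberedMap

section BaseChange

variable {C : Type u₁} [Category.{v₁} C] {K : C ⥤ B}

/-- The fibers of the base change are ordered by arrows over `K.map (𝟙 I)`, which equals `𝟙 (K.obj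
I)` only propositionally. The two preorders on the same type therefore have to be compared
explicitly. -/
theorem baseChange_le_iff {I : C} {φ ψ : P.Pred (K.obj I)} :
    (show (P.baseChange K).Pred I from φ) ≤ (show (P.baseChange K).Pred I from ψ) ↔ φ ≤ ψ := by
  change P.Arr (K.map (𝟙 I)) φ ψ ↔ P.Arr (𝟙 _) φ ψ
  rw [K.map_id]

theorem baseChange_isTop_iff {I : C} {φ : P.Pred (K.obj I)} :
    IsTop (show (P.baseChange K).Pred I from φ) ↔ IsTop φ :=
  forall_congr' fun _ => baseChange_le_iff

theorem baseChange_isGLB_iff {I : C} {φ ψ μ : P.Pred (K.obj I)} :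
    IsGLB (α := (P.baseChange K).Pred I) {φ, ψ} μ ↔ IsGLB {φ, ψ} μ := by
  refine isGLB_pair_iff.trans (Iff.trans ?_
    (isGLB_pair_iff (α := P.Pred (K.obj I)) (a := φ) (b := ψ) (m := μ)).symm)
  exact forall_congr' fun _ =>
    iff_congr baseChange_le_iff (and_congr baseChange_le_iff baseChange_le_iff)

theorem baseChange_isImp_iff {I : C} {φ ψ c : P.Pred (K.obj I)} :
    IsImp (P := P.baseChange K) (I := I) φ ψ c ↔ IsImp φ ψ c :=
  forall₂_congr fun _ _ => imp_congr baseChange_isGLB_iff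
    (iff_congr baseChange_le_iff baseChange_le_iff)

theorem baseChange_isForall_iff {I J : C} {f : I ⟶ J} {ψ : P.Pred (K.obj I)}
    {q : P.Pred (K.obj J)} :
    IsForall (P := P.baseChange K) f ψ q ↔ IsForall (K.map f) ψ q :=
  forall_congr' fun _ => iff_congr baseChange_le_iff baseChange_le_iff

theorem HasFiniteMeets.baseChange (h : P.HasFiniteMeets) (K : C ⥤ B) :
    (P.baseChange K).HasFiniteMeets where
  exists_top I := (h.exists_top (K.obj I)).imp fun _ ht => baseChange_isTop_iff.2 ht
  top_reindex u _ ht :=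
    baseChange_isTop_iff.2 (h.top_reindex (K.map u) (baseChange_isTop_iff.1 ht))
  exists_meet φ ψ := (h.exists_meet (I := K.obj _) φ ψ).imp fun _ hμ => baseChange_isGLB_iff.2 hμ
  meet_reindex u _ _ _ hμ :=
    baseChange_isGLB_iff.2 (h.meet_reindex (K.map u) (baseChange_isGLB_iff.1 hμ))

theorem HasImplication.baseChange (h : P.HasImplication) (K : C ⥤ B) :
    (P.baseChange K).HasImplication where
  exists_imp φ ψ := (h.exists_imp (I := K.obj _) φ ψ).imp fun _ hc => baseChange_isImp_iff.2 hc
  imp_reindex u _ _ _ hc :=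
    baseChange_isImp_iff.2 (h.imp_reindex (K.map u) (baseChange_isImp_iff.1 hc))

theorem HasForall.baseChange {W : MorphismProperty B} (h : P.HasForall W) (K : C ⥤ B)
    {W' : MorphismProperty C} (hW : ∀ ⦃I J : C⦄ (f : I ⟶ J), W' f → W (K.map f))
    (hK : ∀ {I J I' J' : C} {f : I ⟶ J} {f' : I' ⟶ J'} {u' : I' ⟶ I} {u : J' ⟶ J},
      IsPullback u' f' f u → IsPullback (K.map u') (K.map f') (K.map f) (K.map u)) :
    (P.baseChange K).HasForall W' where
  exists_forall f hf ψ := (h.exists_forall (K.map f) (hW f hf) ψ).imp fun _ hq =>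
    baseChange_isForall_iff.2 hq
  beckChevalley hf sq _ _ hq := baseChange_isForall_iff.2
    (h.beckChevalley (hW _ hf) (hK sq) (baseChange_isForall_iff.1 hq))

end BaseChange

end PosetalFibration

/-! ### Pullbacks, vertical maps and epimorphisms in the arrow category -/

section ArrowLemmas

variable {S : Type u} [Category.{v} S]

theorem isPullback_arrow {P X Y Z : Arrow S} {p : P ⟶ X} {q : P ⟶ Y} {f : X ⟶ Z} {g : Y ⟶ Z}
    (hl : IsPullback p.left q.left f.left g.left)
    (hr : IsPullback p.right q.right f.right g.right) : IsPullback p q f g := by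
  refine IsPullback.mk' (Arrow.hom_ext _ _ hl.w hr.w) ?_ ?_
  · intro T a b h₁ h₂
    refine Arrow.hom_ext _ _ (hl.hom_ext ?_ ?_) (hr.hom_ext ?_ ?_)
    · exact congrArg CommaMorphism.left h₁
    · exact congrArg CommaMorphism.left h₂
    · exact congrArg CommaMorphism.right h₁
    · exact congrArg CommaMorphism.right h₂
  · intro T a b h
    have h₁ : a.left ≫ f.left = b.left ≫ g.left := congrArg CommaMorphism.left h
    have h₂ : a.right ≫ f.right = b.right ≫ g.right := congrArg CommaMorphism.right h
    have w : hl.lift a.left b.left h₁ ≫ P.hom = T.hom ≫ hr.lift a.right b.right h₂ := by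
      apply hr.hom_ext
      · rw [Category.assoc, Category.assoc, hr.lift_fst, ← Arrow.w p, ← Arrow.w a,
          ← Category.assoc, hl.lift_fst]
      · rw [Category.assoc, Category.assoc, hr.lift_snd, ← Arrow.w q, ← Arrow.w b,
          ← Category.assoc, hl.lift_snd]
    refine ⟨Arrow.homMk _ _ w, ?_, ?_⟩
    · exact Arrow.hom_ext _ _ (hl.lift_fst _ _ _) (hr.lift_fst _ _ _)
    · exact Arrow.hom_ext _ _ (hl.lift_snd _ _ _) (hr.lift_snd _ _ _)

/-- The domain functor is right adjoint to `T ↦ (T = T)` and so preserves pullbacks; `ext` is the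
transpose under this adjunction. -/
theorem isPullback_left {P X Y Z : Arrow S} {p : P ⟶ X} {q : P ⟶ Y} {f : X ⟶ Z}
    {g : Y ⟶ Z} (h : IsPullback p q f g) : IsPullback p.left q.left f.left g.left := by
  let ext {T : S} {Y : Arrow S} (a : T ⟶ Y.left) : Arrow.mk (𝟙 T) ⟶ Y :=
    Arrow.homMk a (a ≫ Y.hom) (Category.id_comp _).symm
  have comp {T : S} {Y Y' : Arrow S} (a : T ⟶ Y.left) (f : Y ⟶ Y') :
      ext a ≫ f = ext (a ≫ f.left) := by
    refine Arrow.hom_ext _ _ rfl ?_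
    change (a ≫ Y.hom) ≫ f.right = (a ≫ f.left) ≫ Y'.hom
    rw [Category.assoc, Category.assoc, Arrow.w f]
  refine IsPullback.mk' (congrArg CommaMorphism.left h.w) ?_ ?_
  · intro T a b h₁ h₂
    exact congrArg CommaMorphism.left (h.hom_ext (k := ext a) (l := ext b)
      (by rw [comp, comp, h₁]) (by rw [comp, comp, h₂]))
  · intro T a b hab
    have w : ext a ≫ f = ext b ≫ g := by rw [comp, comp, hab]
    exact ⟨(h.lift _ _ w).left, congrArg CommaMorphism.left (h.lift_fst _ _ w),
      congrArg CommaMorphism.left (h.lift_snd _ _ w)⟩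

/-- In a Beck-Chevalley square only one of the two quantified maps is assumed vertical. The opposite
one need not have an identity as its codomain part, but it is invertible there, which is all that
the adjunction for `∀` requires. -/
theorem isIso_right_of_isPullback {P X Y Z : Arrow S} {p : P ⟶ X} {q : P ⟶ Y} {f : X ⟶ Z}
    {g : Y ⟶ Z} (h : IsPullback p q f g) [IsIso f.right] : IsIso q.right := by
  have hw : p.right ≫ f.right = q.right ≫ g.right := congrArg CommaMorphism.right h.w
  -- Replacing the codomain of `P` by that of `Y` gives another cone over the same cospan. The
  -- induced map back to `P` has the inverse of `q.right` as its codomain part.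
  let a : Arrow.mk (P.hom ≫ q.right) ⟶ X := Arrow.homMk p.left (g.right ≫ inv f.right) (by
    change p.left ≫ X.hom = (P.hom ≫ q.right) ≫ g.right ≫ inv f.right
    rw [Arrow.w p, Category.assoc, ← Category.assoc q.right, ← hw, Category.assoc,
      IsIso.hom_inv_id, Category.comp_id])
  let b : Arrow.mk (P.hom ≫ q.right) ⟶ Y := Arrow.homMk q.left (𝟙 _) (by
    change q.left ≫ Y.hom = (P.hom ≫ q.right) ≫ 𝟙 _
    rw [Arrow.w q, Category.comp_id])
  let c : P ⟶ Arrow.mk (P.hom ≫ q.right) := Arrow.homMk (𝟙 _) q.right (Category.id_comp _)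
  have w : a ≫ f = b ≫ g := by
    refine Arrow.hom_ext _ _ (congrArg CommaMorphism.left h.w :) ?_
    change (g.right ≫ inv f.right) ≫ f.right = 𝟙 _ ≫ g.right
    rw [Category.assoc, IsIso.inv_hom_id, Category.comp_id, Category.id_comp]
  have hl : c ≫ h.lift a b w = 𝟙 P := by
    apply h.hom_ext
    · rw [Category.assoc, h.lift_fst, Category.id_comp]
      refine Arrow.hom_ext _ _ (Category.id_comp _) ?_
      change q.right ≫ g.right ≫ inv f.right = p.right
      rw [← Category.assoc, ← hw, Category.assoc, IsIso.hom_inv_id, Category.comp_id]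
    · rw [Category.assoc, h.lift_snd, Category.id_comp]
      exact Arrow.hom_ext _ _ (Category.id_comp _) (Category.comp_id _)
  exact ⟨(h.lift a b w).right, congrArg CommaMorphism.right hl,
    congrArg CommaMorphism.right (h.lift_snd a b w)⟩

theorem vertical_homMk {M N L : S} {m : M ⟶ L} {n : N ⟶ L} (e : M ⟶ N) (w : e ≫ n = m) :
    Vertical (Arrow.homMk e (𝟙 L) (by simp [w]) : Arrow.mk m ⟶ Arrow.mk n) := by
  subst w
  exact Vertical.intro e n

theorem Vertical.isIso_right {m n : Arrow S} {f : m ⟶ n} (h : Vertical f) : IsIso f.right := by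
  cases h
  exact inferInstanceAs (IsIso (𝟙 _))

theorem epi_homMk {m n : Arrow S} (e : m.left ⟶ n.left) (k : m.right ⟶ n.right)
    (w : e ≫ n.hom = m.hom ≫ k) [Epi e] [Epi k] : Epi (Arrow.homMk e k w : m ⟶ n) where
  left_cancellation g h hgh := by
    refine Arrow.hom_ext _ _ ?_ ?_
    · rw [← cancel_epi e]
      exact congrArg CommaMorphism.left hgh
    · rw [← cancel_epi k]
      exact congrArg CommaMorphism.right hgh

variable [CartesianMonoidalCategory S]

/-- The domain functor is left adjoint to `M ↦ (M ⟶ 1)`, so that it preserves epimorphisms. -/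
theorem epi_left {m n : Arrow S} (f : m ⟶ n) [Epi f] : Epi f.left where
  left_cancellation {Z} g h hgh := by
    let g' : n ⟶ (toTerminal S).obj Z := Arrow.homMk g (toUnit _) (toUnit_unique _ _)
    let h' : n ⟶ (toTerminal S).obj Z := Arrow.homMk h (toUnit _) (toUnit_unique _ _)
    have : g' = h' := by
      rw [← cancel_epi f]
      exact Arrow.hom_ext _ _ hgh (toUnit_unique _ _)
    exact congrArg CommaMorphism.left this

theorem toTerminal_hom_ext {m : Arrow S} {M : S} {f g : m ⟶ (toTerminal S).obj M}
    (h : f.left = g.left) : f = g :=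
  Arrow.hom_ext _ _ h (toUnit_unique _ _)

theorem vertical_toTerminal_map {M N : S} (f : M ⟶ N) : Vertical ((toTerminal S).map f) :=
  vertical_homMk f (toUnit_unique _ _)

theorem isPullback_toTerminal_map {M N M' N' : S} {f : M ⟶ N} {f' : M' ⟶ N'} {u' : M' ⟶ M}
    {u : N' ⟶ N} (h : IsPullback u' f' f u) :
    IsPullback ((toTerminal S).map u') ((toTerminal S).map f') ((toTerminal S).map f)
      ((toTerminal S).map u) :=
  isPullback_arrow h (IsPullback.id_vert (𝟙 _))

/-- The object `G × M ⟶ L` for `m : M ⟶ L`. -/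
def prodArrow (G : S) (m : Arrow S) : Arrow S :=
  Arrow.mk (snd G m.left ≫ m.hom)

/-- The projection from `G × M` to `M`, over `L`. -/
def prodProj (G : S) (m : Arrow S) : prodArrow G m ⟶ m :=
  Arrow.homMk (snd G m.left) (𝟙 m.right) (by simp [prodArrow])

/-- The projection from `G × M` to `G`. -/
def prodFst (G : S) (m : Arrow S) : prodArrow G m ⟶ (toTerminal S).obj G :=
  Arrow.homMk (fst G m.left) (toUnit _) (toUnit_unique _ _)

/-- The functoriality of `prodArrow`. -/
def prodMap (G : S) {m' m : Arrow S} (u : m' ⟶ m) : prodArrow G m' ⟶ prodArrow G m :=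
  Arrow.homMk (G ◁ u.left) u.right (by simp [prodArrow])

/-- The section of `prodProj` given by a map to `G`. -/
def prodSection {G : S} {m : Arrow S} (f : m ⟶ (toTerminal S).obj G) : m ⟶ prodArrow G m :=
  Arrow.homMk (lift f.left (𝟙 _)) (𝟙 _)
    ((lift_snd_assoc _ _ _).trans ((Category.id_comp _).trans (Category.comp_id _).symm))

theorem vertical_prodProj (G : S) (m : Arrow S) : Vertical (prodProj G m) :=
  Vertical.intro (snd G m.left) m.hom

theorem isPullback_whiskerLeft_snd (G : S) {M M' : S} (u : M' ⟶ M) :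
    IsPullback (G ◁ u) (snd G M') (snd G M) u := by
  refine IsPullback.mk' (by simp) ?_ ?_
  · intro T a b h₁ h₂
    ext
    · simpa using h₁ =≫ fst _ _
    · exact h₂
  · intro T a b h
    refine ⟨lift (a ≫ fst G M) b, ?_, lift_snd _ _⟩
    ext <;> simp [h]

theorem isPullback_prodMap (G : S) {m' m : Arrow S} (u : m' ⟶ m) :
    IsPullback (prodMap G u) (prodProj G m') (prodProj G m) u :=
  isPullback_arrow (isPullback_whiskerLeft_snd G u.left) (IsPullback.id_vert u.right)

theorem prodMap_prodFst (G : S) {m' m : Arrow S} (u : m' ⟶ m) :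
    prodMap G u ≫ prodFst G m = prodFst G m' :=
  toTerminal_hom_ext (whiskerLeft_fst G u.left)

theorem prodSection_prodProj {G : S} {m : Arrow S} (f : m ⟶ (toTerminal S).obj G) :
    prodSection f ≫ prodProj G m = 𝟙 m :=
  Arrow.hom_ext _ _ (lift_snd (show m.left ⟶ G from f.left) (𝟙 m.left)) (Category.comp_id _)

theorem prodSection_prodFst {G : S} {m : Arrow S} (f : m ⟶ (toTerminal S).obj G) :
    prodSection f ≫ prodFst G m = f :=
  toTerminal_hom_ext (lift_fst (show m.left ⟶ G from f.left) (𝟙 m.left))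

end ArrowLemmas

/-! ### Second-order encoding of disjunction -/

namespace PosetalFibration

variable {S : Type u} [Category.{v} S] [CartesianMonoidalCategory S]
  {X : PosetalFibration.{w} (Arrow S)} {G : S} (tr : X.Pred ((toTerminal S).obj G))

/-- `j` is the disjunction of `φ` and `ψ` given by the second-order encoding
`∀ p, (φ ⇒ p) ∧ (ψ ⇒ p) ⇒ p`. -/
def IsEncodedJoin {m : Arrow S} (φ ψ j : X.Pred m) : Prop :=
  ∃ a b c d : X.Pred (prodArrow G m),
    IsImp (X.reindex (prodProj G m) φ) (X.reindex (prodFst G m) tr) a ∧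
    IsImp (X.reindex (prodProj G m) ψ) (X.reindex (prodFst G m) tr) b ∧
    IsGLB {a, b} c ∧ IsImp c (X.reindex (prodFst G m) tr) d ∧ IsForall (prodProj G m) d j

variable {tr}

/-- Each ingredient of the encoding is stable under reindexing, the quantifier by the Beck-Chevalley
condition for the square of `isPullback_prodMap`. -/
theorem IsEncodedJoin.reindex (hm : X.HasFiniteMeets) (hi : X.HasImplication)
    (hf : X.HasForall Vertical) {m' m : Arrow S} (u : m' ⟶ m) {φ ψ j : X.Pred m}
    (h : IsEncodedJoin tr φ ψ j) :
    IsEncodedJoin tr (X.reindex u φ) (X.reindex u ψ) (X.reindex u j) := by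
  obtain ⟨a, b, c, d, ha, hb, hc, hd, hj⟩ := h
  have hg : AntisymmRel (· ≤ ·) (X.reindex (prodMap G u) (X.reindex (prodFst G m) tr))
      (X.reindex (prodFst G m') tr) :=
    prodMap_prodFst G u ▸ X.reindex_comp (prodMap G u) (prodFst G m) tr
  have sq := isPullback_prodMap G u
  exact ⟨X.reindex (prodMap G u) a, X.reindex (prodMap G u) b, X.reindex (prodMap G u) c,
    X.reindex (prodMap G u) d,
    (hi.imp_reindex _ ha).congr (X.reindex_square sq.w φ) hg (.refl _ _),
    (hi.imp_reindex _ hb).congr (X.reindex_square sq.w ψ) hg (.refl _ _),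
    hm.meet_reindex _ hc, (hi.imp_reindex _ hd).congr (.refl _ _) hg (.refl _ _),
    hf.beckChevalley (vertical_prodProj G m) sq hj⟩

theorem reindex_prodSection_prodProj {m : Arrow S} (f : m ⟶ (toTerminal S).obj G) (φ : X.Pred m) :
    AntisymmRel (· ≤ ·) (X.reindex (prodSection f) (X.reindex (prodProj G m) φ)) φ :=
  (X.reindex_comp _ _ φ).trans (by rw [prodSection_prodProj]; exact X.reindex_id φ)

theorem reindex_prodSection_prodFst {m : Arrow S} (f : m ⟶ (toTerminal S).obj G) :
    AntisymmRel (· ≤ ·) (X.reindex (prodSection f) (X.reindex (prodFst G m) tr))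
      (X.reindex f tr) := by
  have h := X.reindex_comp (prodSection f) (prodFst G m) tr
  rwa [prodSection_prodFst] at h

theorem IsEncodedJoin.isLUB (hm : X.HasFiniteMeets) (hi : X.HasImplication)
    (htr : IsGeneric tr) {m : Arrow S} {φ ψ j : X.Pred m} (h : IsEncodedJoin tr φ ψ j) :
    IsLUB {φ, ψ} j := by
  obtain ⟨a, b, c, d, ha, hb, hc, hd, hj⟩ := h
  rw [isLUB_pair_iff]
  refine fun χ => ⟨fun hle => ⟨le_trans ?_ hle, le_trans ?_ hle⟩, fun ⟨h₁, h₂⟩ => ?_⟩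
  · exact (hj φ).2 (hd.intro hm fun θ hθ hθc => ha.mp hm (hθc.trans (hc.1 (by simp))) hθ)
  · exact (hj ψ).2 (hd.intro hm fun θ hθ hθc => hb.mp hm (hθc.trans (hc.1 (by simp))) hθ)
  -- Genericity makes `χ` a value of the quantified variable `p`: reindexing along the section given
  -- by `f` instantiates `p` with `χ`, and both premises `φ ⇒ χ` and `ψ ⇒ χ` become true.
  · obtain ⟨f, hf⟩ := htr χ
    have hg := (reindex_prodSection_prodFst (X := X) (tr := tr) f).trans hf.symm
    obtain ⟨t, ht⟩ := hm.exists_top m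
    have hc' := hm.meet_reindex (prodSection f) hc
    have hta := (((hi.imp_reindex (prodSection f) ha).congr
      (reindex_prodSection_prodProj f φ) hg (.refl _ _)).isTop_iff hm).2 h₁
    have htb := (((hi.imp_reindex (prodSection f) hb).congr
      (reindex_prodSection_prodProj f ψ) hg (.refl _ _)).isTop_iff hm).2 h₂
    have hjd : j ≤ X.reindex (prodSection f) d :=
      (reindex_prodSection_prodProj f j).2.trans (X.reindex_mono _ ((hj j).1 le_rfl))
    refine ((hi.imp_reindex (prodSection f) hd).congr (.refl _ _) hg (.refl _ _)).mp hm hjd ?_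
    exact (isGLB_pair_iff.1 hc' j).2 ⟨hta j, htb j⟩

/-- Since `⊥` is `∀ p, p` and `∨` is encoded similarly, the requirement of joins in a fibered tripos
follows from its other structure. -/
theorem hasFiniteJoins_of_isGeneric (hm : X.HasFiniteMeets) (hi : X.HasImplication)
    (hf : X.HasForall Vertical) (htr : IsGeneric tr) : X.HasFiniteJoins := by
  have bot (m : Arrow S) : ∃ t : X.Pred m, IsForall (prodProj G m) (X.reindex (prodFst G m) tr) t :=
    hf.exists_forall _ (vertical_prodProj G m) _
  have isBot {m : Arrow S} {t : X.Pred m}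
      (ht : IsForall (prodProj G m) (X.reindex (prodFst G m) tr) t) : IsBot t := by
    intro χ
    obtain ⟨f, hf⟩ := htr χ
    exact (reindex_prodSection_prodProj f t).2.trans ((X.reindex_mono _ ((ht t).1 le_rfl)).trans
      ((reindex_prodSection_prodFst f).trans hf.symm).1)
  have join {m : Arrow S} (φ ψ : X.Pred m) : ∃ j, IsEncodedJoin tr φ ψ j := by
    obtain ⟨a, ha⟩ := hi.exists_imp (X.reindex (prodProj G m) φ) (X.reindex (prodFst G m) tr)
    obtain ⟨b, hb⟩ := hi.exists_imp (X.reindex (prodProj G m) ψ) (X.reindex (prodFst G m) tr)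
    obtain ⟨c, hc⟩ := hm.exists_meet a b
    obtain ⟨d, hd⟩ := hi.exists_imp c (X.reindex (prodFst G m) tr)
    obtain ⟨j, hj⟩ := hf.exists_forall _ (vertical_prodProj G m) d
    exact ⟨j, a, b, c, d, ha, hb, hc, hd, hj⟩
  exact
    { exists_bot := fun m => (bot m).imp fun _ => isBot
      bot_reindex := by
        intro m' m u t ht χ
        -- An arbitrary least element lies below the encoded one, whose reindexing is again the
        -- encoded one and hence least.
        obtain ⟨t', ht'⟩ := bot m
        have hg : AntisymmRel (· ≤ ·) (X.reindex (prodMap G u) (X.reindex (prodFst G m) tr))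
            (X.reindex (prodFst G m') tr) :=
          prodMap_prodFst G u ▸ X.reindex_comp (prodMap G u) (prodFst G m) tr
        have h := (hf.beckChevalley (vertical_prodProj G m) (isPullback_prodMap G u) ht').congr hg
          (.refl _ _)
        exact (X.reindex_mono u (ht t')).trans (isBot h χ)
      exists_join := fun φ ψ => (join φ ψ).imp fun _ h => h.isLUB hm hi htr
      join_reindex := by
        intro m' m u φ ψ μ hμ
        obtain ⟨j, hj⟩ := join φ ψ
        have hlub := hj.isLUB hm hi htr
        have e : AntisymmRel (· ≤ ·) j μ := ⟨hlub.2 hμ.1, hμ.2 hlub.1⟩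
        exact isLUB_pair_congr (.refl _ _) (.refl _ _) (X.reindex_congr u e)
          ((hj.reindex hm hi hf u).isLUB hm hi htr) }

end PosetalFibration

open PosetalFibration

/-! ### From uniform preorders to fibered triposes, and their maps -/

section UniformLemmas

variable {S : Type u} [Category.{v} S] [CartesianMonoidalCategory S] [MonoidalClosed S]
  [HasFiniteLimits S] [HasSubobjectClassifier S]

namespace UniformPreorder

theorem ufam_le_iff {𝔄 : UniformPreorder S} {m : Arrow S} {φ ψ : m.left ⟶ 𝔄.carrier} :
    (show 𝔄.ufam.Pred m from φ) ≤ (show 𝔄.ufam.Pred m from ψ) ↔ 𝔄.LEOver m.hom φ ψ := by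
  change 𝔄.LEOver m.hom φ (𝟙 m.left ≫ ψ) ↔ _
  rw [Category.id_comp]

theorem leOver_epi_comp_iff (𝔄 : UniformPreorder S) {M N L : S} (e : M ⟶ N) [Epi e] (n : N ⟶ L)
    {φ ψ : N ⟶ 𝔄.carrier} : 𝔄.LEOver (e ≫ n) (e ≫ φ) (e ≫ ψ) ↔ 𝔄.LEOver n φ ψ := by
  unfold LEOver
  rw [graphOver_epi_comp]

theorem factors_comp_name_graphOver_iff (𝔄 : UniformPreorder S) {M L M' L' : S} {t' : M' ⟶ M}
    {m' : M' ⟶ L'} {m : M ⟶ L} {t : L' ⟶ L} (sq : IsPullback t' m' m t) (φ ψ : M ⟶ 𝔄.carrier) :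
    𝔄.rel.Factors (t ≫ name (graphOver m φ ψ)) ↔ 𝔄.LEOver m' (t' ≫ φ) (t' ≫ ψ) := by
  unfold LEOver
  rw [comp_name, pullback_graphOver sq]

/-- An epimorphism onto the domain does not change the image that defines the order. -/
theorem ufam_isPrestack (𝔄 : UniformPreorder S) :
    𝔄.ufam.IsPrestack (Vertical ⊓ MorphismProperty.epimorphisms (Arrow S)) := by
  rintro I J e ⟨hv, he⟩ φ ψ h
  have : Epi e := he
  have : Epi e.left := epi_left e
  cases hv with
  | intro e n =>
    have : Epi e := this
    exact ufam_le_iff.2 ((𝔄.leOver_epi_comp_iff e n).1 (ufam_le_iff.1 h))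

theorem ufam_horizontallyDefinable (𝔄 : UniformPreorder S) : HorizontallyDefinable 𝔄.ufam := by
  intro m φ ψ
  -- The subobject is `{l | {(φ x, ψ x) | x ∈ M_l} ∈ R}`.
  refine ⟨(Subobject.pullback (name (graphOver m.hom φ ψ))).obj 𝔄.rel, fun T t => ?_⟩
  have h := (pullback_factors (name (graphOver m.hom φ ψ)) 𝔄.rel t).trans
    (𝔄.factors_comp_name_graphOver_iff (IsPullback.of_hasPullback m.hom t) φ ψ)
  exact h.trans (ufam_le_iff (m := Arrow.mk (pullback.snd m.hom t))
    (φ := pullback.fst m.hom t ≫ φ) (ψ := pullback.fst m.hom t ≫ ψ)).symm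

/-- The identity of the carrier is a generic predicate. -/
theorem ufam_isGeneric (𝔄 : UniformPreorder S) :
    IsGeneric (P := 𝔄.ufam) (G := (toTerminal S).obj 𝔄.carrier) (𝟙 𝔄.carrier) := by
  intro m φ
  have e : φ = 𝔄.ufam.reindex (Arrow.homMk φ (toUnit _) (toUnit_unique _ _) :
      m ⟶ (toTerminal S).obj 𝔄.carrier) (𝟙 𝔄.carrier) := (Category.comp_id _).symm
  exact ⟨_, e.le, e.ge⟩

theorem HasLogic.isFiberedTripos {𝔄 : UniformPreorder S} (h : 𝔄.HasLogic) :
    IsFiberedTripos 𝔄.ufam where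
  prestack := 𝔄.ufam_isPrestack
  definable := 𝔄.ufam_horizontallyDefinable
  meets := h.meets
  joins := hasFiniteJoins_of_isGeneric h.meets h.implication h.forall_vertical 𝔄.ufam_isGeneric
  implication := h.implication
  forall_vertical := h.forall_vertical
  generic := ⟨𝔄.carrier, 𝟙 _, 𝔄.ufam_isGeneric⟩

namespace MonotoneMap

variable {𝔄 𝔅 : UniformPreorder S}

/-- The order on maps is the fiberwise comparison at the generic predicate `𝟙`, of which all other
instances are reindexings. -/
theorem ufam_mono_iff {f g : MonotoneMap 𝔄 𝔅} : f ≤ g ↔ f.ufam ≤ g.ufam := by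
  constructor
  · intro h m φ
    exact ufam_le_iff.2 (𝔅.leOver_reindex φ (toUnit m.right) (toUnit_unique _ _) h)
  · intro h
    have h' := ufam_le_iff.1 (h (I := (toTerminal S).obj 𝔄.carrier) (𝟙 𝔄.carrier))
    have h'' : 𝔅.LEOver (toUnit 𝔄.carrier) (𝟙 𝔄.carrier ≫ f.hom) (𝟙 𝔄.carrier ≫ g.hom) := h'
    rwa [Category.id_comp, Category.id_comp] at h''

/-- The Yoneda argument: `φ` is the reindexing of `𝟙` along `φ` itself, and `F` commutes with
reindexing. -/
theorem app_antisymmRel (F : FiberedMap 𝔄.ufam 𝔅.ufam) {m : Arrow S} (φ : m.left ⟶ 𝔄.carrier) :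
    AntisymmRel (α := 𝔅.ufam.Pred m) (· ≤ ·) (F.app (I := m) φ)
      (CategoryStruct.comp (Y := 𝔄.carrier) φ
        (F.app (I := (toTerminal S).obj 𝔄.carrier) (𝟙 𝔄.carrier))) := by
  let u : m ⟶ (toTerminal S).obj 𝔄.carrier := Arrow.homMk φ (toUnit _) (toUnit_unique _ _)
  have e : φ = 𝔄.ufam.reindex u (𝟙 𝔄.carrier) := (Category.comp_id _).symm
  conv => arg 2; rw [e]
  exact F.app_reindex u (𝟙 𝔄.carrier)

theorem exists_ufam (F : FiberedMap 𝔄.ufam 𝔅.ufam) :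
    ∃ f : MonotoneMap 𝔄 𝔅, AntisymmRel (· ≤ ·) F f.ufam := by
  let f : 𝔄.carrier ⟶ 𝔅.carrier := F.app (I := (toTerminal S).obj 𝔄.carrier) (𝟙 𝔄.carrier)
  have mono {M L : S} (m : M ⟶ L) (φ ψ : M ⟶ 𝔄.carrier) (h : 𝔄.LEOver m φ ψ) :
      𝔅.LEOver m (φ ≫ f) (ψ ≫ f) := by
    have h₁ := F.mono (I := Arrow.mk m) (ufam_le_iff.2 h)
    exact ufam_le_iff.1 (((app_antisymmRel F (m := Arrow.mk m) φ).2.trans h₁).trans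
      (app_antisymmRel F (m := Arrow.mk m) ψ).1)
  refine ⟨⟨f, fun {T} r hr => ?_⟩, fun m φ => (app_antisymmRel F φ).1,
    fun m φ => (app_antisymmRel F φ).2⟩
  -- Monotonicity of `F` on predicates gives internal monotonicity on relations, because the two
  -- projections of `r` are predicates whose order over `T` says exactly that `r` is in `R`.
  have h := mono (r.arrow ≫ snd _ _) (r.arrow ≫ fst _ _ ≫ fst _ _) (r.arrow ≫ fst _ _ ≫ snd _ _)
    (by rw [LEOver, graphOver_arrow]; exact hr)
  rw [LEOver, graphOver] at h
  convert h using 4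
  ext <;> simp

theorem isEquivalence_iff (f : MonotoneMap 𝔄 𝔅) : f.IsEquivalence ↔ f.ufam.IsEquivalence := by
  have aux {ℭ 𝔇 : UniformPreorder S} {M L : S} (m : M ⟶ L) (φ : M ⟶ ℭ.carrier)
      (a : ℭ.carrier ⟶ 𝔇.carrier) (b : 𝔇.carrier ⟶ ℭ.carrier)
      (h₁ : ℭ.LEOver (toUnit ℭ.carrier) (a ≫ b) (𝟙 _))
      (h₂ : ℭ.LEOver (toUnit ℭ.carrier) (𝟙 _) (a ≫ b)) :
      AntisymmRel (α := ℭ.ufam.Pred (Arrow.mk m)) (· ≤ ·) ((φ ≫ a) ≫ b) φ := by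
    have h₁' := ℭ.leOver_reindex (m' := m) φ (toUnit L) (toUnit_unique _ _) h₁
    have h₂' := ℭ.leOver_reindex (m' := m) φ (toUnit L) (toUnit_unique _ _) h₂
    rw [Category.comp_id, ← Category.assoc] at h₁' h₂'
    exact ⟨ufam_le_iff.2 h₁', ufam_le_iff.2 h₂'⟩
  constructor
  · rintro ⟨g, ⟨h₁, h₂⟩, h₃, h₄⟩
    exact ⟨g.ufam, fun m φ => aux m.hom φ f.hom g.hom h₁ h₂,
      fun m φ => aux m.hom φ g.hom f.hom h₃ h₄⟩
  · rintro ⟨G, h₁, h₂⟩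
    obtain ⟨g, hg₁, hg₂⟩ := exists_ufam G
    have k₁ : AntisymmRel (α := 𝔄.ufam.Pred ((toTerminal S).obj 𝔄.carrier)) (· ≤ ·)
        (g.ufam.app (I := (toTerminal S).obj 𝔄.carrier)
          (f.ufam.app (I := (toTerminal S).obj 𝔄.carrier) (𝟙 𝔄.carrier))) (𝟙 𝔄.carrier) :=
      AntisymmRel.trans ⟨hg₂ _, hg₁ _⟩ (h₁ ((toTerminal S).obj 𝔄.carrier) (𝟙 𝔄.carrier))
    have k₂ : AntisymmRel (α := 𝔅.ufam.Pred ((toTerminal S).obj 𝔅.carrier)) (· ≤ ·)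
        (f.ufam.app (I := (toTerminal S).obj 𝔅.carrier)
          (g.ufam.app (I := (toTerminal S).obj 𝔅.carrier) (𝟙 𝔅.carrier))) (𝟙 𝔅.carrier) :=
      (f.ufam.congr ⟨hg₂ _, hg₁ _⟩).trans (h₂ ((toTerminal S).obj 𝔅.carrier) (𝟙 𝔅.carrier))
    have l₁ : 𝔄.LEOver (toUnit 𝔄.carrier) ((𝟙 𝔄.carrier ≫ f.hom) ≫ g.hom) (𝟙 _) :=
      (ufam_le_iff (m := (toTerminal S).obj 𝔄.carrier) (φ := (𝟙 𝔄.carrier ≫ f.hom) ≫ g.hom)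
        (ψ := 𝟙 𝔄.carrier)).1 k₁.1
    have l₂ : 𝔄.LEOver (toUnit 𝔄.carrier) (𝟙 _) ((𝟙 𝔄.carrier ≫ f.hom) ≫ g.hom) :=
      (ufam_le_iff (m := (toTerminal S).obj 𝔄.carrier) (φ := 𝟙 𝔄.carrier)
        (ψ := (𝟙 𝔄.carrier ≫ f.hom) ≫ g.hom)).1 k₁.2
    have l₃ : 𝔅.LEOver (toUnit 𝔅.carrier) ((𝟙 𝔅.carrier ≫ g.hom) ≫ f.hom) (𝟙 _) :=
      (ufam_le_iff (m := (toTerminal S).obj 𝔅.carrier) (φ := (𝟙 𝔅.carrier ≫ g.hom) ≫ f.hom)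
        (ψ := 𝟙 𝔅.carrier)).1 k₂.1
    have l₄ : 𝔅.LEOver (toUnit 𝔅.carrier) (𝟙 _) ((𝟙 𝔅.carrier ≫ g.hom) ≫ f.hom) :=
      (ufam_le_iff (m := (toTerminal S).obj 𝔅.carrier) (φ := 𝟙 𝔅.carrier)
        (ψ := (𝟙 𝔅.carrier ≫ g.hom) ≫ f.hom)).1 k₂.2
    rw [Category.id_comp] at l₁ l₂ l₃ l₄
    exact ⟨g, ⟨l₁, l₂⟩, l₃, l₄⟩

end MonotoneMap

end UniformPreorder

end UniformLemmas

/-! ### Predicates classified by maps into the generic object -/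

section Generic

variable {S : Type u} [Category.{v} S] [CartesianMonoidalCategory S]
  {X : PosetalFibration.{w} (Arrow S)} {G : S} (tr : X.Pred ((toTerminal S).obj G))

/-- The predicate on `m` classified by `φ : m.left ⟶ G`. -/
def genPred (m : Arrow S) (φ : m.left ⟶ G) : X.Pred m :=
  X.reindex (Arrow.homMk φ (toUnit _) (toUnit_unique _ _) : m ⟶ (toTerminal S).obj G) tr

theorem reindex_genPred {m' m : Arrow S} (u : m' ⟶ m) (φ : m.left ⟶ G) :
    AntisymmRel (· ≤ ·) (X.reindex u (genPred tr m φ)) (genPred tr m' (u.left ≫ φ)) := by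
  have e : u ≫ (Arrow.homMk φ (toUnit _) (toUnit_unique _ _) : m ⟶ (toTerminal S).obj G) =
      Arrow.homMk (u.left ≫ φ) (toUnit _) (toUnit_unique _ _) := toTerminal_hom_ext rfl
  have h := X.reindex_comp u (Arrow.homMk φ (toUnit _) (toUnit_unique _ _)) tr
  rwa [e] at h

/-- The order of the predicates on `m` classified by `φ` and `ψ`. -/
def GenLE {M L : S} (m : M ⟶ L) (φ ψ : M ⟶ G) : Prop :=
  genPred tr (Arrow.mk m) φ ≤ genPred tr (Arrow.mk m) ψ

variable {tr}

theorem GenLE.reindex {M L M' L' : S} {m : M ⟶ L} {m' : M' ⟶ L'} {φ ψ : M ⟶ G}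
    (h : GenLE tr m φ ψ) (u : M' ⟶ M) (k : L' ⟶ L) (w : u ≫ m = m' ≫ k) :
    GenLE tr m' (u ≫ φ) (u ≫ ψ) := by
  let f : Arrow.mk m' ⟶ Arrow.mk m := Arrow.homMk u k w
  exact ((reindex_genPred tr f φ).2.trans (X.reindex_mono f h)).trans (reindex_genPred tr f ψ).1

theorem GenLE.of_epi_comp
    (hX : X.IsPrestack (Vertical ⊓ MorphismProperty.epimorphisms (Arrow S)))
    {M N L : S} (e : M ⟶ N) [Epi e] {n : N ⟶ L} {φ ψ : N ⟶ G}
    (h : GenLE tr (e ≫ n) (e ≫ φ) (e ≫ ψ)) : GenLE tr n φ ψ := by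
  let f : Arrow.mk (e ≫ n) ⟶ Arrow.mk n := Arrow.homMk e (𝟙 L)
  have : Epi (𝟙 L) := inferInstance
  have he : Epi f := @epi_homMk _ _ (Arrow.mk (e ≫ n)) (Arrow.mk n) e (𝟙 L) _ ‹_› this
  exact hX f ⟨Vertical.intro e n, he⟩ _ _
    (((reindex_genPred tr f φ).1.trans h).trans (reindex_genPred tr f ψ).2)

theorem genPred_surjective (htr : IsGeneric tr) {m : Arrow S} (χ : X.Pred m) :
    ∃ φ : m.left ⟶ G, AntisymmRel (· ≤ ·) (genPred tr m φ) χ := by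
  obtain ⟨f, hf⟩ := htr χ
  have e : f = Arrow.homMk f.left (toUnit _) (toUnit_unique _ _) := toTerminal_hom_ext rfl
  rw [e] at hf
  exact ⟨f.left, hf.symm⟩

end Generic

/-! ### Horizontal definability on arbitrary pullback squares -/

section Definable

variable {S : Type u} [Category.{v} S] [HasPullbacks S]

/-- Horizontal definability, tested on arbitrary pullback squares. -/
theorem HorizontallyDefinable.exists_subobject {X : PosetalFibration.{w} (Arrow S)}
    (hX : HorizontallyDefinable X) {m : Arrow S} (φ ψ : X.Pred m) :
    ∃ U : Subobject m.right, ∀ {m' : Arrow S} (f : m' ⟶ m),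
      IsPullback f.left m'.hom m.hom f.right →
        (U.Factors f.right ↔ X.reindex f φ ≤ X.reindex f ψ) := by
  obtain ⟨U, hU⟩ := hX φ ψ
  refine ⟨U, fun {m'} f sq => ?_⟩
  have key {a b : Arrow S} (g : a ⟶ b) (p : b ⟶ m) (q : a ⟶ m) (e : g ≫ p = q)
      (h : X.reindex p φ ≤ X.reindex p ψ) : X.reindex q φ ≤ X.reindex q ψ := by
    subst e
    exact ((X.reindex_comp_le g p φ).trans (X.reindex_mono g h)).trans (X.le_reindex_comp g p ψ)
  rw [hU]
  let i : m' ⟶ Arrow.mk (pullback.snd m.hom f.right) :=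
    Arrow.homMk (pullback.lift f.left m'.hom sq.w) (𝟙 _)
      ((pullback.lift_snd _ _ _).trans (Category.comp_id _).symm)
  let j : Arrow.mk (pullback.snd m.hom f.right) ⟶ m' :=
    Arrow.homMk (sq.lift (pullback.fst _ _) (pullback.snd _ _) pullback.condition) (𝟙 _)
      ((sq.lift_snd _ _ _).trans (Category.comp_id _).symm)
  exact ⟨key i _ _ (Arrow.hom_ext _ _ (pullback.lift_fst _ _ _) (Category.id_comp _)),
    key j _ _ (Arrow.hom_ext _ _ (sq.lift_fst _ _ _) (Category.id_comp _))⟩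

end Definable

/-! ### The uniform preorder of a fibered tripos -/

section UniformOfTripos

variable {S : Type u} [Category.{v} S] [CartesianMonoidalCategory S] [MonoidalClosed S]
  [HasFiniteLimits S] [HasSubobjectClassifier S]
  {X : PosetalFibration.{w} (Arrow S)} {G : S} {tr : X.Pred ((toTerminal S).obj G)}

/-- The relations `r` on `G` such that `a ≤ b` for `(a, b) ∈ r` are internally definable. -/
theorem exists_rel_of_definable (hX : HorizontallyDefinable X) :
    ∃ R : Subobject (Pow (G ⊗ G)), ∀ {T : S} (r : Subobject ((G ⊗ G) ⊗ T)),
      R.Factors (name r) ↔ GenLE tr (r.arrow ≫ snd _ _) (r.arrow ≫ fst _ _ ≫ fst _ _)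
        (r.arrow ≫ fst _ _ ≫ snd _ _) := by
  -- `E` is the membership relation. Regarded as an object over `Pow (G ⊗ G)`, it carries the
  -- universal pair of predicates, and `R` is the subobject over which the first lies below the
  -- second.
  obtain ⟨E, hE⟩ := name_surjective (𝟙 (Pow (G ⊗ G)))
  let m : Arrow S := Arrow.mk (E.arrow ≫ snd _ _)
  obtain ⟨R, hR⟩ := hX.exists_subobject (m := m)
    (genPred tr m (E.arrow ≫ fst _ _ ≫ fst _ _)) (genPred tr m (E.arrow ≫ fst _ _ ≫ snd _ _))
  refine ⟨R, fun {T} r => ?_⟩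
  -- Every family is the pullback of the membership relation along its name, so the defining
  -- property of `R` applies to it.
  obtain ⟨t, rfl⟩ : ∃ t : T ⟶ Pow (G ⊗ G), r = (Subobject.pullback ((G ⊗ G) ◁ t)).obj E :=
    ⟨name r, name_injective (by rw [← comp_name, hE, Category.comp_id])⟩
  rw [← comp_name, hE, Category.comp_id]
  have sq₁ := Subobject.isPullback ((G ⊗ G) ◁ t) E
  have sq := sq₁.paste_vert (isPullback_whiskerLeft_snd (G ⊗ G) t)
  let m' : Arrow S := Arrow.mk (((Subobject.pullback ((G ⊗ G) ◁ t)).obj E).arrow ≫ snd _ _)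
  let f : m' ⟶ m := Arrow.homMk (Subobject.pullbackπ ((G ⊗ G) ◁ t) E) t sq.w
  have h := hR f sq
  refine h.trans ?_
  rw [(reindex_genPred tr f _).le_congr_left, (reindex_genPred tr f _).le_congr_right]
  have e {Z : S} (p : G ⊗ G ⟶ Z) : Subobject.pullbackπ ((G ⊗ G) ◁ t) E ≫ E.arrow ≫ fst _ _ ≫ p =
      ((Subobject.pullback ((G ⊗ G) ◁ t)).obj E).arrow ≫ fst _ _ ≫ p := by
    rw [← Category.assoc, sq₁.w, Category.assoc, whiskerLeft_fst_assoc]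
  exact iff_of_eq (congrArg₂ (GenLE tr _) (e (fst G G)) (e (snd G G)))

/-- The map from `M` onto the image of `(φ, ψ, m)` is an epimorphism over `L`, along which the
pre-stack condition reflects the order. -/
theorem genLE_graphOver_iff
    (hX : X.IsPrestack (Vertical ⊓ MorphismProperty.epimorphisms (Arrow S))) {M L : S}
    (m : M ⟶ L) (φ ψ : M ⟶ G) :
    GenLE tr ((graphOver m φ ψ).arrow ≫ snd _ _) ((graphOver m φ ψ).arrow ≫ fst _ _ ≫ fst _ _)
      ((graphOver m φ ψ).arrow ≫ fst _ _ ≫ snd _ _) ↔ GenLE tr m φ ψ := by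
  have : Epi ((graphOver m φ ψ).factorThru _ (image_factors (lift (lift φ ψ) m))) :=
    epi_factorThru_image _
  let k := (graphOver m φ ψ).factorThru _ (image_factors (lift (lift φ ψ) m))
  have hk : k ≫ (graphOver m φ ψ).arrow = lift (lift φ ψ) m := Subobject.factorThru_arrow _ _ _
  have e₁ : k ≫ (graphOver m φ ψ).arrow ≫ snd _ _ = m := by
    rw [← Category.assoc, hk, lift_snd]
  have e₂ : k ≫ (graphOver m φ ψ).arrow ≫ fst _ _ ≫ fst _ _ = φ := by
    rw [← Category.assoc, hk, lift_fst_assoc, lift_fst]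
  have e₃ : k ≫ (graphOver m φ ψ).arrow ≫ fst _ _ ≫ snd _ _ = ψ := by
    rw [← Category.assoc, hk, lift_fst_assoc, lift_snd]
  constructor
  · intro h
    have h' := h.reindex (m' := m) k (𝟙 L) (by rw [e₁, Category.comp_id])
    rwa [e₂, e₃] at h'
  · intro h
    refine GenLE.of_epi_comp hX k ?_
    rwa [e₁, e₂, e₃]

/-- The uniform preorder of a generic predicate. -/
def uniformOfGeneric
    (hX : X.IsPrestack (Vertical ⊓ MorphismProperty.epimorphisms (Arrow S)))
    (R : Subobject (Pow (G ⊗ G)))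
    (hR : ∀ {T : S} (r : Subobject ((G ⊗ G) ⊗ T)), R.Factors (name r) ↔
      GenLE tr (r.arrow ≫ snd _ _) (r.arrow ≫ fst _ _ ≫ fst _ _)
        (r.arrow ≫ fst _ _ ≫ snd _ _)) : UniformPreorder S where
  carrier := G
  rel := R
  down r s hle h := by
    rw [hR] at h ⊢
    have h' := h.reindex (m' := s.arrow ≫ snd _ _) (Subobject.ofLE s r hle) (𝟙 _) (by simp)
    simpa using h'
  refl := by
    rw [hR, genLE_graphOver_iff hX]
    exact le_rfl
  comp {T} r s hr hs := by
    rw [hR] at hr hs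
    -- `K` consists of the triples `(a, b, c)` with `r (a, b)` and `s (b, c)`. Transitivity is
    -- applied over `K`, and the image in the definition of `relComp` is then absorbed by
    -- `genLE_graphOver_iff`.
    let K := (Subobject.pullback (proj₁₂ G T)).obj r ⊓ (Subobject.pullback (proj₂₃ G T)).obj s
    let f := K.arrow ≫ proj₁₃ G T
    have hK := (Subobject.inf_factors _).1 (Subobject.factors_self K)
    rw [pullback_factors, pullback_factors] at hK
    have e : relComp r s = graphOver (f ≫ snd _ _) (f ≫ fst _ _ ≫ fst _ _)
        (f ≫ fst _ _ ≫ snd _ _) := by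
      unfold relComp graphOver
      congr 1
      ext <;> simp [f, K]
    rw [e, hR, genLE_graphOver_iff hX]
    have h₁ := hr.reindex (m' := f ≫ snd _ _) (r.factorThru _ hK.1) (𝟙 _)
      (by simp [f, proj₁₂, proj₁₃])
    have h₂ := hs.reindex (m' := f ≫ snd _ _) (s.factorThru _ hK.2) (𝟙 _)
      (by simp [f, proj₂₃, proj₁₃])
    simp only [Subobject.factorThru_arrow_assoc] at h₁ h₂
    simp only [f, proj₁₂, proj₂₃, proj₁₃, Category.assoc, lift_fst_assoc, lift_snd, lift_fst]
      at h₁ h₂ ⊢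
    exact le_trans h₁ h₂

theorem IsFiberedTripos.exists_uniformPreorder (hX : IsFiberedTripos X) :
    ∃ 𝔄 : UniformPreorder S, 𝔄.HasLogic ∧ ∃ F : FiberedMap 𝔄.ufam X, F.IsEquivalence := by
  obtain ⟨G, tr, htr⟩ := hX.generic
  obtain ⟨R, hR⟩ := exists_rel_of_definable (tr := tr) hX.definable
  let 𝔄 := uniformOfGeneric hX.prestack R hR
  have key {m : Arrow S} {φ ψ : m.left ⟶ G} :
      (show 𝔄.ufam.Pred m from φ) ≤ (show 𝔄.ufam.Pred m from ψ) ↔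
        genPred tr m φ ≤ genPred tr m ψ :=
    (UniformPreorder.ufam_le_iff (𝔄 := 𝔄)).trans
      ((hR _).trans (genLE_graphOver_iff hX.prestack m.hom φ ψ))
  let F : FiberedMap 𝔄.ufam X := FiberedMap.ofMono (fun {m} φ => genPred tr m φ)
    (fun h => key.1 h) fun u φ => (reindex_genPred tr u φ).symm
  have hF : F.IsFiberwiseEquiv := ⟨fun h => key.2 h, fun χ => genPred_surjective htr χ⟩
  exact ⟨𝔄, ⟨hF.hasFiniteMeets hX.meets, hF.hasImplication hX.implication,
    hF.hasForall hX.forall_vertical⟩, F, FiberedMap.isEquivalence_iff.2 hF⟩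

end UniformOfTripos

/-! ### The fibered posetal fibration of a tripos with `γ` -/

section GammaLemmas

variable {S : Type u} [Category.{v} S] [CartesianMonoidalCategory S] [HasFiniteLimits S]

theorem isTop_iff_of_isGLB {α : Type w} [Preorder α] {a b c : α} (h : IsGLB {a, b} c) :
    IsTop c ↔ IsTop a ∧ IsTop b :=
  ⟨fun hc => ⟨isTop_of_le hc (h.1 (by simp)), isTop_of_le hc (h.1 (by simp))⟩,
    fun hab x => (isGLB_pair_iff.1 h x).2 ⟨hab.1 x, hab.2 x⟩⟩

theorem factors_iff_pullback_eq_top {X Y : S} (U : Subobject Y) (t : X ⟶ Y) :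
    U.Factors t ↔ (Subobject.pullback t).obj U = ⊤ := by
  rw [eq_top_iff, le_iff_factors]
  refine ⟨fun h Z z _ => (pullback_factors t U z).2 (Subobject.factors_of_factors_right z h),
    fun h => ?_⟩
  have := (pullback_factors t U (𝟙 X)).1 (h X (𝟙 X) (Subobject.top_factors _))
  rwa [Category.id_comp] at this

theorem eq_top_iff_factors_id {Y : S} (U : Subobject Y) : U = ⊤ ↔ U.Factors (𝟙 Y) := by
  rw [factors_iff_pullback_eq_top, Subobject.pullback_id]

variable {P : PosetalFibration.{w} S} {γ : FiberedMap P (sub S)}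

theorem gamma_mono {I : S} {φ ψ : P.Pred I} (h : φ ≤ ψ) (ht : IsTop (γ.app φ)) :
    IsTop (γ.app ψ) :=
  isTop_of_le ht (γ.mono h)

theorem gamma_app_reindex {I J : S} (u : I ⟶ J) (φ : P.Pred J) :
    γ.app (P.reindex u φ) = (Subobject.pullback u).obj (γ.app φ) :=
  le_antisymm (α := Subobject I) (sub_le_iff.1 (γ.app_reindex u φ).1) (sub_le_iff.1 (γ.app_reindex u φ).2)

/-- As `γ` commutes with reindexing, `γ φ` is the locus where `φ` becomes true in the sense of `γ`.
-/
theorem isTop_gamma_reindex_iff {I J : S} (u : I ⟶ J) (φ : P.Pred J) :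
    IsTop (γ.app (P.reindex u φ)) ↔ Subobject.Factors (γ.app φ) u := by
  refine sub_isTop_iff.trans ?_
  rw [gamma_app_reindex]
  exact (factors_iff_pullback_eq_top _ _).symm

theorem isTop_gamma_reindex {I J : S} (u : I ⟶ J) {φ : P.Pred J} (h : IsTop (γ.app φ)) :
    IsTop (γ.app (P.reindex u φ)) := by
  rw [isTop_gamma_reindex_iff]
  have e : γ.app φ = (⊤ : Subobject J) := sub_isTop_iff.1 h
  exact e ▸ Subobject.top_factors u

theorem leOver_iff (h : IsTriposWithGamma P γ) {M L : S} {m : M ⟶ L} {φ ψ c : P.Pred M}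
    {q : P.Pred L} (hc : IsImp φ ψ c) (hq : IsForall m c q) :
    LEOver P γ m φ ψ ↔ IsTop (γ.app q) := by
  refine ⟨?_, fun ht => ⟨c, q, hc, hq, ht⟩⟩
  rintro ⟨c', q', hc', hq', ht⟩
  exact gamma_mono (hq'.mono hq (hc'.antisymmRel h.meets hc).1) ht

/-- Any `p` over `L` under which `φ` entails `ψ` lies below `∀_m (φ ⇒ ψ)`, and that predicate is
itself such a `p`. This replaces the order of `ofGamma` by entailment in `P` under a hypothesis with
`γ p = ⊤`. -/
theorem leOver_iff_exists (h : IsTriposWithGamma P γ) {M L : S} {m : M ⟶ L} {φ ψ : P.Pred M} :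
    LEOver P γ m φ ψ ↔ ∃ p : P.Pred L, IsTop (γ.app p) ∧
      ∀ χ, χ ≤ P.reindex m p → χ ≤ φ → χ ≤ ψ := by
  constructor
  · rintro ⟨c, q, hc, hq, ht⟩
    exact ⟨q, ht, fun χ h₁ h₂ => hc.mp h.meets (h₁.trans ((hq q).1 le_rfl)) h₂⟩
  · rintro ⟨p, ht, hp⟩
    obtain ⟨c, hc⟩ := h.implication.exists_imp φ ψ
    obtain ⟨q, hq⟩ := h.forall_all.exists_forall m trivial c
    exact ⟨c, q, hc, hq, gamma_mono ((hq p).2 (hc.intro h.meets hp)) ht⟩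

/-- Finitely many instances of `LEOver` may be assumed to hold under the same hypothesis. -/
theorem LEOver.exists_common (h : IsTriposWithGamma P γ) {M L : S} {m : M ⟶ L}
    {φ ψ φ' ψ' : P.Pred M} (h₁ : LEOver P γ m φ ψ) (h₂ : LEOver P γ m φ' ψ') :
    ∃ p : P.Pred L, IsTop (γ.app p) ∧ (∀ χ, χ ≤ P.reindex m p → χ ≤ φ → χ ≤ ψ) ∧
      ∀ χ, χ ≤ P.reindex m p → χ ≤ φ' → χ ≤ ψ' := by
  obtain ⟨p, hp, k⟩ := (leOver_iff_exists h).1 h₁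
  obtain ⟨p', hp', k'⟩ := (leOver_iff_exists h).1 h₂
  obtain ⟨r, hr⟩ := h.meets.exists_meet p p'
  exact ⟨r, (isTop_iff_of_isGLB (h.gamma_meet hr)).2 ⟨hp, hp'⟩,
    fun χ hχ => k χ (hχ.trans (P.reindex_mono m (hr.1 (by simp)))),
    fun χ hχ => k' χ (hχ.trans (P.reindex_mono m (hr.1 (by simp))))⟩

theorem ofGamma_le_iff (h : IsTriposWithGamma P γ) {m : Arrow S} {φ ψ : P.Pred m.left} :
    (show (ofGamma h).Pred m from φ) ≤ (show (ofGamma h).Pred m from ψ) ↔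
      LEOver P γ m.hom φ ψ := by
  change LEOver P γ m.hom φ (P.reindex (𝟙 m.left) ψ) ↔ _
  exact ⟨fun k => leOver_trans h _ k (leOver_of_le h _ (P.reindex_id_le ψ)),
    fun k => leOver_trans h _ k (leOver_of_le h _ (P.le_reindex_id ψ))⟩

theorem ofGamma_le (h : IsTriposWithGamma P γ) {m : Arrow S} {φ ψ : P.Pred m.left}
    (hle : φ ≤ ψ) : (show (ofGamma h).Pred m from φ) ≤ (show (ofGamma h).Pred m from ψ) :=
  (ofGamma_le_iff h).2 (leOver_of_le h _ hle)

theorem ofGamma_isTop (h : IsTriposWithGamma P γ) {m : Arrow S} {t : P.Pred m.left}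
    (ht : IsTop t) : IsTop (show (ofGamma h).Pred m from t) :=
  fun φ => ofGamma_le h (ht φ)

theorem ofGamma_isGLB (h : IsTriposWithGamma P γ) {m : Arrow S} {φ ψ μ : P.Pred m.left}
    (hμ : IsGLB {φ, ψ} μ) : IsGLB (α := (ofGamma h).Pred m) {φ, ψ} μ := by
  refine isGLB_pair_iff.2 fun θ => ⟨fun hle => ⟨hle.trans (ofGamma_le h (hμ.1 (by simp))),
    hle.trans (ofGamma_le h (hμ.1 (by simp)))⟩, fun ⟨h₁, h₂⟩ => ?_⟩
  obtain ⟨p, hp, k₁, k₂⟩ := LEOver.exists_common h ((ofGamma_le_iff h).1 h₁)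
    ((ofGamma_le_iff h).1 h₂)
  exact (ofGamma_le_iff h).2 ((leOver_iff_exists h).2 ⟨p, hp, fun χ hχ hθ =>
    (isGLB_pair_iff.1 hμ χ).2 ⟨k₁ χ hχ hθ, k₂ χ hχ hθ⟩⟩)

theorem ofGamma_hasFiniteMeets (h : IsTriposWithGamma P γ) : (ofGamma h).HasFiniteMeets := by
  refine HasFiniteMeets.mk_of_exists ?_ ?_ ?_
  · exact fun m => (h.meets.exists_top m.left).imp fun _ ht => ofGamma_isTop h ht
  · intro m' m u t ht
    obtain ⟨t₀, ht₀⟩ := h.meets.exists_top m.left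
    exact isTop_of_le (ofGamma_isTop h (h.meets.top_reindex u.left ht₀))
      ((ofGamma h).reindex_mono u (ht t₀))
  · intro m φ ψ
    obtain ⟨μ, hμ⟩ := h.meets.exists_meet (I := m.left) φ ψ
    exact ⟨μ, ofGamma_isGLB h hμ, fun u => ofGamma_isGLB h (h.meets.meet_reindex u.left hμ)⟩

theorem ofGamma_isImp (h : IsTriposWithGamma P γ) {m : Arrow S} {φ ψ c : P.Pred m.left}
    (hc : IsImp φ ψ c) : IsImp (P := ofGamma h) (I := m) φ ψ c := by
  refine (isImp_iff (ofGamma_hasFiniteMeets h)).2 fun θ => ⟨fun hle χ h₁ h₂ => ?_, fun k => ?_⟩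
  · obtain ⟨p, hp, k₁, k₂⟩ := LEOver.exists_common h ((ofGamma_le_iff h).1 (h₁.trans hle))
      ((ofGamma_le_iff h).1 h₂)
    exact (ofGamma_le_iff h).2 ((leOver_iff_exists h).2 ⟨p, hp, fun ξ hξ hξ' =>
      hc.mp h.meets (k₁ ξ hξ hξ') (k₂ ξ hξ hξ')⟩)
  -- The assumption is used at the meet taken in `P`; the hypothesis `p` obtained there also serves
  -- for the implication.
  · obtain ⟨μ, hμ⟩ := h.meets.exists_meet (I := m.left) θ φ
    obtain ⟨hμθ, hμφ⟩ := (isGLB_pair_iff.1 hμ μ).1 le_rfl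
    have hμψ := k μ (ofGamma_le h hμθ) (ofGamma_le h hμφ)
    obtain ⟨p, hp, k⟩ := (leOver_iff_exists h).1 ((ofGamma_le_iff h).1 hμψ)
    exact (ofGamma_le_iff h).2 ((leOver_iff_exists h).2 ⟨p, hp, fun ξ hξ hθ =>
      hc.intro h.meets fun ζ hζ hφ => k ζ (hζ.trans hξ)
        ((isGLB_pair_iff.1 hμ ζ).2 ⟨hζ.trans hθ, hφ⟩)⟩)

theorem ofGamma_hasImplication (h : IsTriposWithGamma P γ) : (ofGamma h).HasImplication where
  exists_imp {m} φ ψ := (h.implication.exists_imp (I := m.left) φ ψ).imp fun _ hc =>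
    ofGamma_isImp h hc
  imp_reindex {m' m} u φ ψ c hc := by
    -- The given implication is one for the coarser order only, but it is isomorphic there to one
    -- computed in `P`, for which stability is known.
    obtain ⟨c₀, hc₀⟩ := h.implication.exists_imp (I := m.left) φ ψ
    exact (ofGamma_isImp h (h.implication.imp_reindex u.left hc₀)).congr (.refl _ _) (.refl _ _)
      ((ofGamma h).reindex_congr u
        ((ofGamma_isImp h hc₀).antisymmRel (ofGamma_hasFiniteMeets h) hc))

/-- Quantification along a map that is invertible on codomains does not disturb the hypothesis `p`,
which lives on the codomain and is only transported along `k`. -/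
theorem leOver_of_reindex_leOver (h : IsTriposWithGamma P γ) {M N L L' : S} {m : M ⟶ L}
    {n : N ⟶ L'} {e : M ⟶ N} {k : L ⟶ L'} [IsIso k] (w : e ≫ n = m ≫ k) {θ q : P.Pred N}
    {ψ : P.Pred M} (hq : IsForall e ψ q) (hle : LEOver P γ m (P.reindex e θ) ψ) :
    LEOver P γ n θ q := by
  obtain ⟨p, hp, hψ⟩ := (leOver_iff_exists h).1 hle
  refine (leOver_iff_exists h).2 ⟨P.reindex (inv k) p, isTop_gamma_reindex _ hp,
    fun χ h₁ h₂ => (hq χ).2 (hψ _ ?_ (P.reindex_mono e h₂))⟩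
  refine (P.reindex_mono e h₁).trans ((P.reindex_mono e (P.le_reindex_comp _ _ _)).trans
    ((P.le_reindex_comp _ _ _).trans ?_))
  have e' : e ≫ n ≫ inv k = m := by rw [← Category.assoc, w, Category.assoc, IsIso.hom_inv_id,
    Category.comp_id]
  rw [e']

theorem ofGamma_isForall (h : IsTriposWithGamma P γ) {m n : Arrow S} {f : m ⟶ n} [IsIso f.right]
    {ψ : P.Pred m.left} {q : P.Pred n.left} (hq : IsForall f.left ψ q) :
    IsForall (P := ofGamma h) f ψ q := by
  intro θ
  refine ⟨fun hle => ((ofGamma h).reindex_mono f hle).trans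
    (ofGamma_le h ((hq q).1 le_rfl)), fun hle => ?_⟩
  exact (ofGamma_le_iff h).2 (leOver_of_reindex_leOver h f.w hq ((ofGamma_le_iff h).1 hle))

theorem ofGamma_hasForall (h : IsTriposWithGamma P γ) : (ofGamma h).HasForall Vertical where
  exists_forall f hf ψ := by
    have := hf.isIso_right
    exact (h.forall_all.exists_forall f.left trivial ψ).imp fun _ hq => ofGamma_isForall h hq
  beckChevalley {_ _ _ _ f f' u' u} hf sq ψ q hq := by
    have := hf.isIso_right
    have := isIso_right_of_isPullback sq
    obtain ⟨q₀, hq₀⟩ := h.forall_all.exists_forall f.left trivial ψ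
    exact (ofGamma_isForall h (h.forall_all.beckChevalley trivial (isPullback_left sq)
      hq₀)).congr (.refl _ _) ((ofGamma h).reindex_congr u
        ((ofGamma_isForall h hq₀).antisymmRel hq))

theorem ofGamma_horizontallyDefinable (h : IsTriposWithGamma P γ) :
    HorizontallyDefinable (ofGamma h) := by
  intro m φ ψ
  obtain ⟨c, hc⟩ := h.implication.exists_imp (I := m.left) φ ψ
  obtain ⟨q, hq⟩ := h.forall_all.exists_forall m.hom trivial c
  -- The subobject is `γ (∀_m (φ ⇒ ψ))`, whose pullback along `t` is computed by the Beck-Chevalley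
  -- condition in `P`.
  refine ⟨γ.app q, fun T t => ?_⟩
  have sq := IsPullback.of_hasPullback m.hom t
  exact (isTop_gamma_reindex_iff t q).symm.trans
    ((leOver_iff h (h.implication.imp_reindex _ hc)
      (h.forall_all.beckChevalley trivial sq hq)).symm.trans
        (ofGamma_le_iff h (m := Arrow.mk (pullback.snd m.hom t))).symm)

theorem ofGamma_isGeneric (h : IsTriposWithGamma P γ) {G : S} {tr : P.Pred G}
    (htr : IsGeneric tr) : IsGeneric (P := ofGamma h) (G := (toTerminal S).obj G) tr := by
  intro m φ
  obtain ⟨f, hf⟩ := htr (I := m.left) φ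
  exact ⟨Arrow.homMk f (toUnit _) (toUnit_unique _ _), ofGamma_le h hf.1, ofGamma_le h hf.2⟩

theorem leOver_toUnit_iff (h : IsTriposWithGamma P γ) {M : S} {φ ψ : P.Pred M} :
    LEOver P γ (toUnit M) φ ψ ↔ φ ≤ ψ := by
  refine ⟨fun hle => ?_, leOver_of_le h _⟩
  obtain ⟨p, hp, k⟩ := (leOver_iff_exists h).1 hle
  -- The hypothesis `p` lives over `1`, where `γ p = ⊤` forces `p` to be true.
  exact k φ (h.meets.top_reindex _ (h.gamma_reflects hp) φ) le_rfl

/-- The comparison of a tripos with `γ` with the fiber over `1` of its fibered tripos. -/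
def toFiberOne (h : IsTriposWithGamma P γ) : FiberedMap P (fiberOne (ofGamma h)) :=
  FiberedMap.ofMono (fun φ => φ) (fun hle => baseChange_le_iff.2 (ofGamma_le h hle))
    fun _ _ => .refl _ _

theorem toFiberOne_isFiberwiseEquiv (h : IsTriposWithGamma P γ) :
    (toFiberOne h).IsFiberwiseEquiv where
  reflects {M _ _} hle := (leOver_toUnit_iff h).1
    ((ofGamma_le_iff h (m := (toTerminal S).obj M)).1 (baseChange_le_iff.1 hle))
  surj ψ := ⟨ψ, .refl _ _⟩

/-- Over `T = T` hypotheses and predicates live on the same object, so `ψ` can be its own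
hypothesis. This is how `γ` is recovered from the fibered tripos. -/
theorem ofGamma_isTop_id_iff (h : IsTriposWithGamma P γ) {T : S} {ψ : P.Pred T} :
    IsTop (show (ofGamma h).Pred (Arrow.mk (𝟙 T)) from ψ) ↔ IsTop (γ.app ψ) := by
  obtain ⟨t, ht⟩ := h.meets.exists_top T
  constructor
  · intro hψ
    obtain ⟨p, hp, k⟩ := (leOver_iff_exists h).1 ((ofGamma_le_iff h (m := Arrow.mk (𝟙 T))).1
      (hψ t))
    exact gamma_mono ((P.le_reindex_id p).trans (k _ le_rfl (ht _))) hp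
  · intro hψ φ
    exact (ofGamma_le_iff h (m := Arrow.mk (𝟙 T))).2 ((leOver_iff_exists h).2
      ⟨ψ, hψ, fun χ hχ _ => hχ.trans (P.reindex_id_le ψ)⟩)

/-- An equivalence of triposes compatible with `γ` induces a fibered map of fibered triposes. -/
def ofGammaMap {P' : PosetalFibration.{w₁} S} {γ' : FiberedMap P' (sub S)}
    (h : IsTriposWithGamma P γ) (h' : IsTriposWithGamma P' γ') (H : FiberedMap P P')
    (hH : ∀ (m : Arrow S) (φ ψ : P.Pred m.left),
      LEOver P γ m.hom φ ψ → LEOver P' γ' m.hom (H.app φ) (H.app ψ)) :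
    FiberedMap (ofGamma h) (ofGamma h') :=
  FiberedMap.ofMono (fun {m} φ => H.app (I := m.left) φ)
    (fun hle => (ofGamma_le_iff h').2 (hH _ _ _ ((ofGamma_le_iff h).1 hle)))
    fun u φ => ⟨ofGamma_le h' (H.app_reindex u.left φ).1, ofGamma_le h' (H.app_reindex u.left φ).2⟩

/-- The order over `m` involves only `⇒` and `∀`, which every equivalence preserves, and `γ`. -/
theorem leOver_app_iff {P' : PosetalFibration.{w₁} S} {γ' : FiberedMap P' (sub S)}
    (h : IsTriposWithGamma P γ) (h' : IsTriposWithGamma P' γ') {H : FiberedMap P P'}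
    (hH : H.IsFiberwiseEquiv) (hγ : ∀ (M : S) (φ : P.Pred M), γ'.app (H.app φ) = γ.app φ)
    {M L : S} {m : M ⟶ L} {φ ψ : P.Pred M} :
    LEOver P' γ' m (H.app φ) (H.app ψ) ↔ LEOver P γ m φ ψ := by
  obtain ⟨c, hc⟩ := h.implication.exists_imp φ ψ
  obtain ⟨q, hq⟩ := h.forall_all.exists_forall m trivial c
  rw [leOver_iff h hc hq, leOver_iff h' (hH.isImp_iff.2 hc) (hH.isForall_iff.2 hq), hγ]

end GammaLemmas

/-! ### The tripos with `γ` of a fibered tripos -/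

section FiberOne

variable {S : Type u} [Category.{v} S] [CartesianMonoidalCategory S] [HasFiniteLimits S]
  {X : PosetalFibration.{w} (Arrow S)}

/-- The canonical map from `M ⟶ L` to `M ⟶ 1`. -/
def toOne (m : Arrow S) : m ⟶ (toTerminal S).obj m.left :=
  Arrow.homMk (𝟙 _) (toUnit _) (toUnit_unique _ _)

theorem gammaApp_factors_iff (hd : HorizontallyDefinable X) (hm : X.HasFiniteMeets) {M T : S}
    (φ : X.Pred ((toTerminal S).obj M)) (t : T ⟶ M) :
    (show Subobject M from gammaApp X hd hm (M := M) φ).Factors t ↔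
      IsTop (X.reindex (idToTerminal T ≫ (toTerminal S).map t) φ) :=
  gammaApp_factors X hd hm φ t

theorem gammaApp_eq_top_iff (hd : HorizontallyDefinable X) (hm : X.HasFiniteMeets) {M : S}
    (φ : X.Pred ((toTerminal S).obj M)) :
    gammaApp X hd hm (M := M) φ = ⊤ ↔ IsTop (X.reindex (idToTerminal M) φ) := by
  have e : idToTerminal M ≫ (toTerminal S).map (𝟙 M) = idToTerminal M :=
    toTerminal_hom_ext (Category.comp_id (𝟙 M))
  refine (eq_top_iff_factors_id _).trans ((gammaApp_factors_iff hd hm φ (𝟙 M)).trans ?_)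
  rw [e]

theorem isTriposWithGamma_fiberOne (hX : IsFiberedTripos X) :
    IsTriposWithGamma (fiberOne X) (gamma X hX.definable hX.meets) where
  prestack {I J} e he φ ψ hle := by
    have : IsRegularEpi e := he
    have : Epi e := (IsRegularEpi.getStruct e).epi
    have hepi : Epi ((toTerminal S).map e) :=
      @epi_homMk _ _ ((toTerminal S).obj I) ((toTerminal S).obj J) e (𝟙 (𝟙_ S)) _ this
        (inferInstanceAs (Epi (𝟙 (𝟙_ S))))
    exact baseChange_le_iff.2 (hX.prestack ((toTerminal S).map e)
      ⟨vertical_toTerminal_map e, hepi⟩ φ ψ (baseChange_le_iff.1 hle))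
  meets := hX.meets.baseChange _
  implication := hX.implication.baseChange _
  forall_all := hX.forall_vertical.baseChange _ (fun _ _ f _ => vertical_toTerminal_map f)
    isPullback_toTerminal_map
  generic := by
    obtain ⟨G, tr, htr⟩ := hX.generic
    refine ⟨G, tr, fun M φ => ?_⟩
    obtain ⟨f, hf⟩ := htr (I := (toTerminal S).obj M) φ
    have e : f = (toTerminal S).map f.left := toTerminal_hom_ext rfl
    rw [e] at hf
    exact ⟨f.left, baseChange_le_iff.2 hf.1, baseChange_le_iff.2 hf.2⟩
  gamma_top {M t} ht := by
    refine sub_isTop_iff.2 ((gammaApp_eq_top_iff hX.definable hX.meets t).2 ?_)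
    exact hX.meets.top_reindex _ (baseChange_isTop_iff.1 ht)
  gamma_meet {M φ ψ μ} hμ := by
    have key {T : S} (t : T ⟶ M) : (gammaApp X hX.definable hX.meets μ).Factors t ↔
        (gammaApp X hX.definable hX.meets φ).Factors t ∧
          (gammaApp X hX.definable hX.meets ψ).Factors t := by
      rw [gammaApp_factors, gammaApp_factors, gammaApp_factors]
      exact isTop_iff_of_isGLB (hX.meets.meet_reindex _ (baseChange_isGLB_iff.1 hμ))
    refine isGLB_pair_iff.2 fun U => ?_
    refine sub_le_iff.trans (Iff.trans ?_ (and_congr sub_le_iff sub_le_iff).symm)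
    have aux (V : Subobject M) : V ≤ gammaApp X hX.definable hX.meets μ ↔
        V ≤ gammaApp X hX.definable hX.meets φ ∧ V ≤ gammaApp X hX.definable hX.meets ψ := by
      rw [le_iff_factors, le_iff_factors, le_iff_factors]
      exact ⟨fun hV => ⟨fun Z z hz => ((key z).1 (hV Z z hz)).1,
        fun Z z hz => ((key z).1 (hV Z z hz)).2⟩,
        fun hV Z z hz => (key z).2 ⟨hV.1 Z z hz, hV.2 Z z hz⟩⟩
    exact aux U
  gamma_reflects {p} hp := by
    have h := (gammaApp_eq_top_iff hX.definable hX.meets p).1 (sub_isTop_iff.1 hp)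
    -- For the terminal object, `1 = 1` and `1 ⟶ 1` are isomorphic, so truth over the one is truth
    -- over the other.
    have : IsIso (idToTerminal (𝟙_ S)).left := inferInstanceAs (IsIso (𝟙 (𝟙_ S)))
    have : IsIso (idToTerminal (𝟙_ S)).right :=
      ⟨toUnit (𝟙_ S), toUnit_unique _ _, toUnit_unique _ _⟩
    have : IsIso (idToTerminal (𝟙_ S)) := Arrow.isIso_of_isIso_left_of_isIso_right _
    exact baseChange_isTop_iff.2
      ((hX.meets.isTop_reindex_iso_iff (asIso (idToTerminal (𝟙_ S))) p).1 h)

/-- This square exhibits `M ⟶ L` as the pullback of `M ⟶ 1` along the map from `L = L` to `L ⟶ 1`.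
Through it, quantification over `1` computes the order over `m`. -/
theorem isPullback_toOne {M L : S} (m : M ⟶ L) :
    IsPullback (toOne (Arrow.mk m)) (Arrow.homMk m (𝟙 L) : Arrow.mk m ⟶ Arrow.mk (𝟙 L))
      ((toTerminal S).map m) (idToTerminal L) :=
  isPullback_arrow (IsPullback.id_horiz m) (IsPullback.id_vert (toUnit L))

/-- After restriction to `L = L`, `∀_m (φ ⇒ ψ)` is true if and only if the implication is true over
`m`, by the Beck-Chevalley condition; and an implication is true exactly when the entailment holds.
-/
theorem leOver_fiberOne_iff (hX : IsFiberedTripos X) {M L : S} (m : M ⟶ L)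
    {φ ψ : (fiberOne X).Pred M} :
    LEOver (fiberOne X) (gamma X hX.definable hX.meets) m φ ψ ↔
      X.reindex (toOne (Arrow.mk m)) φ ≤ X.reindex (toOne (Arrow.mk m)) ψ := by
  have h := isTriposWithGamma_fiberOne hX
  obtain ⟨c, hc⟩ := h.implication.exists_imp φ ψ
  obtain ⟨q, hq⟩ := h.forall_all.exists_forall m trivial c
  have hc' := hX.implication.imp_reindex (toOne (Arrow.mk m)) (baseChange_isImp_iff.1 hc)
  have hq' := hX.forall_vertical.beckChevalley (vertical_toTerminal_map m) (isPullback_toOne m)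
    (baseChange_isForall_iff.1 hq)
  exact (leOver_iff h hc hq).trans (sub_isTop_iff.trans
    ((gammaApp_eq_top_iff hX.definable hX.meets q).trans
      ((hq'.isTop_iff hX.meets).trans (hc'.isTop_iff hX.meets))))

/-- The comparison of a fibered tripos with the one given by its fiber over `1`. -/
def fromOfGamma (hX : IsFiberedTripos X) :
    FiberedMap (ofGamma (isTriposWithGamma_fiberOne hX)) X :=
  FiberedMap.ofMono (fun {m} φ => X.reindex (toOne m) φ)
    (fun {m _ _} hle => (leOver_fiberOne_iff hX m.hom).1
      ((ofGamma_le_iff (isTriposWithGamma_fiberOne hX)).1 hle))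
    fun {m' m} u φ => X.reindex_square (u := toOne m') (t := (toTerminal S).map u.left) (u' := u)
      (t' := toOne m) (toTerminal_hom_ext ((Category.id_comp u.left).trans
        (Category.comp_id u.left).symm)) φ

theorem fromOfGamma_isFiberwiseEquiv (hX : IsFiberedTripos X) :
    (fromOfGamma hX).IsFiberwiseEquiv where
  reflects {m _ _} hle := (ofGamma_le_iff (isTriposWithGamma_fiberOne hX)).2
    ((leOver_fiberOne_iff hX m.hom).2 hle)
  surj {m} ψ := by
    obtain ⟨G, tr, htr⟩ := hX.generic
    obtain ⟨f, hf⟩ := htr ψ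
    -- A map from `m` to an object over `1` factors through `M ⟶ 1`, so every predicate on `m` is
    -- restricted from the fiber over `1`.
    have e : toOne m ≫ (toTerminal S).map f.left = f :=
      toTerminal_hom_ext (Category.id_comp f.left)
    rw [← e] at hf
    exact ⟨X.reindex ((toTerminal S).map f.left) tr, (X.reindex_comp _ _ tr).trans hf.symm⟩

theorem reindex_toOne_toTerminal {M : S} (φ : X.Pred ((toTerminal S).obj M)) :
    AntisymmRel (· ≤ ·) (X.reindex (toOne ((toTerminal S).obj M)) φ) φ := by
  have e : toOne ((toTerminal S).obj M) = 𝟙 _ := toTerminal_hom_ext rfl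
  rw [e]
  exact X.reindex_id φ

variable {Y : PosetalFibration.{w₁} (Arrow S)}

theorem gammaApp_app (hX : IsFiberedTripos X) (hY : IsFiberedTripos Y) {F : FiberedMap X Y}
    (hF : F.IsFiberwiseEquiv) {M : S} (φ : X.Pred ((toTerminal S).obj M)) :
    gammaApp Y hY.definable hY.meets (M := M) (F.app φ) =
      gammaApp X hX.definable hX.meets (M := M) φ := by
  have key {T : S} (t : T ⟶ M) :
      (show Subobject M from gammaApp Y hY.definable hY.meets (M := M) (F.app φ)).Factors t ↔
        (show Subobject M from gammaApp X hX.definable hX.meets (M := M) φ).Factors t := by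
    refine (gammaApp_factors_iff _ _ _ _).trans
      (Iff.trans ?_ (gammaApp_factors_iff _ _ _ _).symm)
    rw [← hF.isTop_iff]
    have e := F.app_reindex (idToTerminal T ≫ (toTerminal S).map t) φ
    exact ⟨fun h => isTop_of_le h e.2, fun h => isTop_of_le h e.1⟩
  exact le_antisymm ((le_iff_factors _ _).2 fun Z z => (key z).1)
    ((le_iff_factors _ _).2 fun Z z => (key z).2)

theorem baseChange_isFiberwiseEquiv {F : FiberedMap X Y} (hF : F.IsFiberwiseEquiv) :
    (F.baseChange (toTerminal S)).IsFiberwiseEquiv where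
  reflects hle := baseChange_le_iff.2 (hF.reflects (baseChange_le_iff.1 hle))
  surj ψ := (hF.surj (I := (toTerminal S).obj _) ψ).imp fun _ h =>
    ⟨baseChange_le_iff.2 h.1, baseChange_le_iff.2 h.2⟩

theorem exists_extension (hX : IsFiberedTripos X) (hY : IsFiberedTripos Y)
    {H : FiberedMap (fiberOne X) (fiberOne Y)} (hH : H.IsFiberwiseEquiv)
    (hγ : ∀ (M : S) (φ : (fiberOne X).Pred M),
      (gamma Y hY.definable hY.meets).app (H.app φ) = (gamma X hX.definable hX.meets).app φ) :
    ∃ F : FiberedMap X Y, F.IsFiberwiseEquiv ∧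
      AntisymmRel (· ≤ ·) (F.baseChange (toTerminal S)) H := by
  have h := isTriposWithGamma_fiberOne hX
  have h' := isTriposWithGamma_fiberOne hY
  -- Compatibility with `γ` makes `H`, acting on the same predicates, monotone over all of `S ↓ S`;
  -- the extension is then obtained by conjugating with the two comparison equivalences.
  let K : FiberedMap (ofGamma h) (ofGamma h') :=
    ofGammaMap h h' H fun _ _ _ => (leOver_app_iff h h' hH hγ).2
  have hK : K.IsFiberwiseEquiv :=
    { reflects := fun hle => (ofGamma_le_iff h).2 ((leOver_app_iff h h' hH hγ).1
        ((ofGamma_le_iff h').1 hle))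
      surj := fun {m} ψ => (hH.surj (I := m.left) ψ).imp fun _ e =>
        ⟨ofGamma_le h' e.1, ofGamma_le h' e.2⟩ }
  have hC := fromOfGamma_isFiberwiseEquiv hX
  have hD := fromOfGamma_isFiberwiseEquiv hY
  refine ⟨(hC.inverse.comp K).comp (fromOfGamma hY),
    (hC.inverse_isFiberwiseEquiv.comp hK).comp hD, ?_⟩
  have key {M : S} (φ : (fiberOne X).Pred M) : AntisymmRel (α := Y.Pred ((toTerminal S).obj M))
      (· ≤ ·) (((hC.inverse.comp K).comp (fromOfGamma hY)).app (I := (toTerminal S).obj M) φ)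
      (H.app φ) := by
    let φ' : (fiberOne X).Pred M := hC.inverse.app (I := (toTerminal S).obj M) φ
    have e₁ : AntisymmRel (α := X.Pred ((toTerminal S).obj M)) (· ≤ ·) φ' φ :=
      -- Over `M ⟶ 1` the comparison maps reindex along identities, so the conjugated map agrees
      -- with `H` up to isomorphism.
      (reindex_toOne_toTerminal (X := X) (M := M) φ').symm.trans
        (hC.app_inverse (I := (toTerminal S).obj M) φ)
    have e₂ := H.congr (φ := φ') (ψ := φ) ⟨baseChange_le_iff.2 e₁.1, baseChange_le_iff.2 e₁.2⟩
    have e₃ : AntisymmRel (α := Y.Pred ((toTerminal S).obj M)) (· ≤ ·) (H.app φ') (H.app φ) :=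
      ⟨baseChange_le_iff.1 e₂.1, baseChange_le_iff.1 e₂.2⟩
    exact (reindex_toOne_toTerminal (X := Y) (M := M) (H.app φ')).trans e₃
  exact ⟨fun M φ => baseChange_le_iff.2 (key φ).1, fun M φ => baseChange_le_iff.2 (key φ).2⟩

/-- The generic predicate lies in the fiber over `1`, and the inequality at it is transported to all
predicates by reindexing. -/
theorem le_iff_baseChange_le (hX : IsFiberedTripos X) {F F' : FiberedMap X Y} :
    F ≤ F' ↔ F.baseChange (toTerminal S) ≤ F'.baseChange (toTerminal S) := by
  refine ⟨fun h M φ => baseChange_le_iff.2 (h (I := (toTerminal S).obj M) φ), fun h m φ => ?_⟩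
  obtain ⟨G, tr, htr⟩ := hX.generic
  obtain ⟨f, hf⟩ := htr φ
  have hle : F.app tr ≤ F'.app tr := baseChange_le_iff.1 (h (I := G) tr)
  exact (F.mono hf.1).trans ((F.app_reindex f tr).1.trans ((Y.reindex_mono f hle).trans
    ((F'.app_reindex f tr).2.trans (F'.mono hf.2))))

end FiberOne

/-! ### From triposes with `γ` to fibered triposes -/

section OfGammaTripos

variable {S : Type u} [Category.{v} S] [CartesianMonoidalCategory S] [MonoidalClosed S]
  [HasFiniteLimits S] [HasSubobjectClassifier S] {P : PosetalFibration.{w} S}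
  {γ : FiberedMap P (sub S)}

theorem ofGamma_isPrestack (h : IsTriposWithGamma P γ) :
    (ofGamma h).IsPrestack (Vertical ⊓ MorphismProperty.epimorphisms (Arrow S)) := by
  rintro I J f ⟨hv, he⟩ φ ψ hle
  have : Epi f := he
  have hepi : Epi f.left := epi_left f
  cases hv with
  | @intro M N L e n =>
    have : Epi e := hepi
    have hle' : LEOver P γ (e ≫ n) (P.reindex e φ) (P.reindex e ψ) :=
      (ofGamma_le_iff h (m := Arrow.mk (e ≫ n))).1 hle
    obtain ⟨p, hp, k⟩ := (leOver_iff_exists h).1 hle'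
    exact (ofGamma_le_iff h (m := Arrow.mk n)).2 ((leOver_iff_exists h).2 ⟨p, hp, fun χ h₁ h₂ =>
      -- The hypothesis `p` lives on the common codomain `L`, so it is unaffected by the cover `e`,
      -- and only the entailment on `M` has to descend to `N`.
      h.prestack e (isRegularEpi_of_epi e) χ ψ (k _
        ((P.reindex_mono e h₁).trans (P.le_reindex_comp e n p)) (P.reindex_mono e h₂))⟩)

theorem IsTriposWithGamma.isFiberedTripos (h : IsTriposWithGamma P γ) :
    IsFiberedTripos (ofGamma h) := by
  obtain ⟨G, tr, htr⟩ := h.generic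
  exact
    { prestack := ofGamma_isPrestack h
      definable := ofGamma_horizontallyDefinable h
      meets := ofGamma_hasFiniteMeets h
      joins := hasFiniteJoins_of_isGeneric (ofGamma_hasFiniteMeets h) (ofGamma_hasImplication h)
        (ofGamma_hasForall h) (ofGamma_isGeneric h htr)
      implication := ofGamma_hasImplication h
      forall_vertical := ofGamma_hasForall h
      generic := ⟨G, tr, ofGamma_isGeneric h htr⟩ }

theorem gammaApp_ofGamma (h : IsTriposWithGamma P γ) (hd : HorizontallyDefinable (ofGamma h))
    (hm : (ofGamma h).HasFiniteMeets) {M : S} (φ : P.Pred M) :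
    gammaApp (ofGamma h) hd hm (M := M) φ = γ.app φ := by
  refine subobject_ext_factors fun T t => (gammaApp_factors _ _ _ _ _).trans ?_
  refine Iff.trans ?_ (isTop_gamma_reindex_iff t φ)
  have e : 𝟙 T ≫ t = t := Category.id_comp t
  exact (ofGamma_isTop_id_iff h (ψ := P.reindex (𝟙 T ≫ t) φ)).trans (by rw [e])

end OfGammaTripos

end TriposTheory

end

theorem theorem4p12p10 {S : Type u} [Category.{v} S] [CartesianMonoidalCategory S]
    [MonoidalClosed S] [HasFiniteLimits S] [HasSubobjectClassifier S] :
    -- from one-sorted uniform preorders with `⊤, ∧, ⇒, ∀` to fibered triposes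
    (∀ 𝔄 : TriposTheory.UniformPreorder S, 𝔄.HasLogic →
      TriposTheory.IsFiberedTripos 𝔄.ufam) ∧
    -- up to equivalence, every fibered tripos arises in this way
    (∀ X : TriposTheory.PosetalFibration.{w₁} (Arrow S), TriposTheory.IsFiberedTripos X →
      ∃ 𝔄 : TriposTheory.UniformPreorder S, 𝔄.HasLogic ∧
        ∃ F : TriposTheory.PosetalFibration.FiberedMap 𝔄.ufam X, F.IsEquivalence) ∧
    -- the maps, in particular the equivalences, between uniform preorders are the same as those
    -- between the associated fibrations
    (∀ 𝔄 𝔅 : TriposTheory.UniformPreorder S,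
      (∀ F : TriposTheory.PosetalFibration.FiberedMap 𝔄.ufam 𝔅.ufam,
        ∃ f : 𝔄.MonotoneMap 𝔅, AntisymmRel (· ≤ ·) F f.ufam) ∧
      (∀ f g : 𝔄.MonotoneMap 𝔅, f ≤ g ↔ f.ufam ≤ g.ufam) ∧
      (∀ f : 𝔄.MonotoneMap 𝔅, f.IsEquivalence ↔ f.ufam.IsEquivalence)) ∧
    -- from fibered triposes to triposes with `γ`, and back
    (∀ (X : TriposTheory.PosetalFibration.{w₁} (Arrow S)) (hX : TriposTheory.IsFiberedTripos X),
      ∃ h : TriposTheory.IsTriposWithGamma (TriposTheory.fiberOne X)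
          (TriposTheory.gamma X hX.definable hX.meets),
        ∃ F : TriposTheory.PosetalFibration.FiberedMap X (TriposTheory.ofGamma h),
          F.IsEquivalence) ∧
    -- from triposes with `γ` to fibered triposes, and back
    (∀ (P : TriposTheory.PosetalFibration.{w₁} S)
      (γ : TriposTheory.PosetalFibration.FiberedMap P (TriposTheory.sub S))
      (h : TriposTheory.IsTriposWithGamma P γ),
      ∃ hX : TriposTheory.IsFiberedTripos (TriposTheory.ofGamma h),
        ∃ F : TriposTheory.PosetalFibration.FiberedMap P
            (TriposTheory.fiberOne (TriposTheory.ofGamma h)),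
          F.IsEquivalence ∧ ∀ (M : S) (φ : P.Pred M),
            (TriposTheory.gamma (TriposTheory.ofGamma h) hX.definable hX.meets).app (F.app φ) =
              γ.app φ) ∧
    -- the equivalences between fibered triposes are the same as the equivalences between the
    -- associated triposes with `γ`
    (∀ (X : TriposTheory.PosetalFibration.{w₁} (Arrow S))
      (Y : TriposTheory.PosetalFibration.{w₂} (Arrow S))
      (hX : TriposTheory.IsFiberedTripos X) (hY : TriposTheory.IsFiberedTripos Y),
      (∀ F : TriposTheory.PosetalFibration.FiberedMap X Y, F.IsEquivalence →
        (F.baseChange (TriposTheory.toTerminal S)).IsEquivalence ∧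
        ∀ (M : S) (φ : (TriposTheory.fiberOne X).Pred M),
          (TriposTheory.gamma Y hY.definable hY.meets).app
              ((F.baseChange (TriposTheory.toTerminal S)).app φ) =
            (TriposTheory.gamma X hX.definable hX.meets).app φ) ∧
      (∀ H : TriposTheory.PosetalFibration.FiberedMap (TriposTheory.fiberOne X)
          (TriposTheory.fiberOne Y), H.IsEquivalence →
        (∀ (M : S) (φ : (TriposTheory.fiberOne X).Pred M),
          (TriposTheory.gamma Y hY.definable hY.meets).app (H.app φ) =
            (TriposTheory.gamma X hX.definable hX.meets).app φ) →
        ∃ F : TriposTheory.PosetalFibration.FiberedMap X Y, F.IsEquivalence ∧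
          AntisymmRel (· ≤ ·) (F.baseChange (TriposTheory.toTerminal S)) H) ∧
      (∀ F G : TriposTheory.PosetalFibration.FiberedMap X Y, F ≤ G ↔
        F.baseChange (TriposTheory.toTerminal S) ≤ G.baseChange (TriposTheory.toTerminal S))) := by
  refine ⟨fun 𝔄 h => h.isFiberedTripos, fun X hX => hX.exists_uniformPreorder, fun 𝔄 𝔅 =>
    ⟨TriposTheory.UniformPreorder.MonotoneMap.exists_ufam,
      fun f g => TriposTheory.UniformPreorder.MonotoneMap.ufam_mono_iff,
      TriposTheory.UniformPreorder.MonotoneMap.isEquivalence_iff⟩, fun X hX => ?_,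
    fun P γ h => ?_, fun X Y hX hY => ⟨fun F hF => ?_, fun H hH hγ => ?_,
      fun F G => TriposTheory.le_iff_baseChange_le hX⟩⟩
  · have hF := TriposTheory.fromOfGamma_isFiberwiseEquiv hX
    exact ⟨TriposTheory.isTriposWithGamma_fiberOne hX, hF.inverse,
      TriposTheory.PosetalFibration.FiberedMap.isEquivalence_iff.2 hF.inverse_isFiberwiseEquiv⟩
  · exact ⟨h.isFiberedTripos, TriposTheory.toFiberOne h,
      TriposTheory.PosetalFibration.FiberedMap.isEquivalence_iff.2
        (TriposTheory.toFiberOne_isFiberwiseEquiv h),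
      fun M φ => TriposTheory.gammaApp_ofGamma h h.isFiberedTripos.definable
        h.isFiberedTripos.meets φ⟩
  · have hF' := TriposTheory.PosetalFibration.FiberedMap.isEquivalence_iff.1 hF
    exact ⟨TriposTheory.PosetalFibration.FiberedMap.isEquivalence_iff.2
      (TriposTheory.baseChange_isFiberwiseEquiv hF'),
      fun M φ => TriposTheory.gammaApp_app hX hY hF' φ⟩
  · obtain ⟨F, hF, e⟩ := TriposTheory.exists_extension hX hY
      (TriposTheory.PosetalFibration.FiberedMap.isEquivalence_iff.1 hH) hγ
    exact ⟨F, TriposTheory.PosetalFibration.FiberedMap.isEquivalence_iff.2 hF, e⟩
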